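/- Theorem 3.2. Let $\varepsilon>0$ and $\boldsymbol D_\varepsilon^*=\{z\in\boldsymbol C: 0<|z|<\varepsilon\}$. An improper affine front on an open set $\Omega\subset\boldsymbol C$ with Weierstrass data $(F,G)$ is a map $$\psi=\Big(G+\overline F,\ \tfrac12\big(|G|^2-|F|^2\big)+\Re\Big(GF-2\int F\,dG\Big)\Big)\colon\Omega\to\boldsymbol C\times\boldsymbol R=\boldsymbol R^3,$$ where $F,G$ are holomorphic on $\Omega$, $(dF,dG)\neq(0,0)$ everywhere and $\Re\int_\gamma F\,dG=0$ for every closed curve $\gamma$ in $\Omega$; it is an improper affine sphere if moreover $|dF|\neq|dG|$ everywhere on $\Omega$. On a punctured disk $\boldsymbol D_\delta^*$ it is complete at $0$ if every path in $\boldsymbol D_\delta^*$ that accumulates to $0$ has infinite length with respect to $ds^2=|dF|^2+|dG|^2+dF\,dG+\overline{dF\,dG}$. Let $\psi\colon\boldsymbol D_\varepsilon^*\to\boldsymbol R^3$ be an improper affine sphere with Weierstrass data $(F,G)$ that is complete at $0$. Then the end $0$ is embedded, that is, $\psi|_{\boldsymbol D_\delta^*}$ is a smooth embedding for some $0<\delta\le\varepsilon$,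 if and only if $\psi$ is asymptotic to a type-P end, a type-R end or a type-NR end. Here $\psi$ is asymptotic to a type-P (resp. type-R, type-NR) end if there are $0<\delta\le\varepsilon$ and a piece $\widetilde\psi\colon\boldsymbol D_\delta^*\to\boldsymbol R^3$, complete at $0$, of one of the following model fronts on $\boldsymbol C\setminus\{0\}$ such that $|\psi(z)-\widetilde\psi(z)|\to0$ in the Euclidean norm of $\boldsymbol R^3$ as $z\to0$: - (P) an elliptic paraboloid, with Weierstrass data $\left(\frac1z,\frac bz\right)$, $b\in\boldsymbol C$, $|b|\ne1$; - (R) a rotational improper affine front, with data $\left(\frac1z,az\right)$, $a\in\boldsymbol R\setminus\{0\}$; - (NR) a non-rotational improper affine front, with data $\left(\frac1z,az+\frac bz\right)$, $a\in\boldsymbol R\setminus\{0\}$, $b\in\boldsymbol C\setminus\{0\}$, $|b|\neq1$. Each model is taken up to parallel translation of $\boldsymbol R^3$ and up to interchanging its two Weierstrass data (which amounts to the half-turn $(x_1,x_2,x_3)\mapsto(x_1,-x_2,-x_3)$ of $\boldsymbol R^3$, up to translation). A piece of a front $\Psi\colon\boldsymbol C\setminus\{0\}\to\boldsymbol R^3$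 is a map $\Psi\circ\varphi$ with $\varphi\colon\boldsymbol D_\delta^*\to\boldsymbol C\setminus\{0\}$ holomorphic and injective; it has the Weierstrass data of $\Psi$ composed with $\varphi$. -/

import Mathlib

open Set Filter Topology MeasureTheory
open scoped ContDiff ComplexConjugate ENNReal

namespace ImproperAffine

/-- The ambient space `ℂ × ℝ = ℝ³` with its Euclidean norm. -/
abbrev Space : Type := WithLp 2 (ℂ × ℝ)

/-- The punctured disk `{0 < |z| < ε}`. -/
def PDisk (ε : ℝ) : Set ℂ := {z | 0 < ‖z‖ ∧ ‖z‖ < ε}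

/-- The 1-form `F dG`. -/
noncomputable def formFdG (F G : ℂ → ℂ) : ℂ → ℂ →L[ℂ] ℂ := fun z => F z • fderiv ℂ G z

/-- `γ` is a `C¹` path that stays in `Ω`. -/
def IsC1PathIn (Ω : Set ℂ) {z w : ℂ} (γ : Path z w) : Prop :=
  ContDiffOn ℝ 1 γ.extend (Icc 0 1) ∧ ∀ t, γ t ∈ Ω

/-- The period condition: `Re ∫_γ F dG = 0` for every closed curve `γ` in `Ω`. -/
def PeriodCondition (Ω : Set ℂ) (F G : ℂ → ℂ) : Prop :=
  ∀ (z : ℂ) (γ : Path z z), IsC1PathIn Ω γ → (curveIntegral (formFdG F G) γ).re = 0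

/-- `h` is a determination of `Re ∫ F dG` on `Ω` (unique up to an additive constant when `Ω` is a
connected open set). -/
def IsReIntegral (Ω : Set ℂ) (F G : ℂ → ℂ) (h : ℂ → ℝ) : Prop :=
  ∀ (z w : ℂ) (γ : Path z w), IsC1PathIn Ω γ → h w - h z = (curveIntegral (formFdG F G) γ).re

/-- `ψ` is an improper affine front (improper affine map) on the open set `Ω ⊆ ℂ` with Weierstrass
data `(F, G)`: `F` and `G` are holomorphic, `(dF, dG)` vanishes nowhere, the period condition holds,
and `ψ = (G + F̄, (|G|² - |F|²) / 2 + Re (G F - 2 ∫ F dG))`. -/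
structure IsImproperAffineFront (Ω : Set ℂ) (F G : ℂ → ℂ) (ψ : ℂ → Space) : Prop where
  holo_F : DifferentiableOn ℂ F Ω
  holo_G : DifferentiableOn ℂ G Ω
  regular : ∀ z ∈ Ω, ¬ (deriv F z = 0 ∧ deriv G z = 0)
  period : PeriodCondition Ω F G
  repr : ∃ h : ℂ → ℝ, IsReIntegral Ω F G h ∧ ∀ z ∈ Ω,
    ψ z = WithLp.toLp 2
      (G z + conj (F z), (‖G z‖ ^ 2 - ‖F z‖ ^ 2) / 2 + (G z * F z).re - 2 * h z)

/-- `ψ` is an improper affine sphere on `Ω` with Weierstrass data `(F, G)`: an improper affine front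
without singular points, that is, whose affine metric `|dG|² - |dF|²` degenerates nowhere. -/
structure IsImproperAffineSphere (Ω : Set ℂ) (F G : ℂ → ℂ) (ψ : ℂ → Space) : Prop
    extends IsImproperAffineFront Ω F G ψ where
  nondegenerate : ∀ z ∈ Ω, ‖deriv F z‖ ≠ ‖deriv G z‖

/-- The flat fundamental form `ds² = |dF|² + |dG|² + dF dG + conj (dF dG)` at `z`, evaluated on the
tangent vector `v`. -/
noncomputable def flatForm (F G : ℂ → ℂ) (z v : ℂ) : ℝ :=
  ‖deriv F z * v‖ ^ 2 + ‖deriv G z * v‖ ^ 2 + 2 * ((deriv F z * v) * (deriv G z * v)).re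

/-- The length of the path `γ : [0, 1) → ℂ` with respect to the flat fundamental form. -/
noncomputable def flatLength (F G : ℂ → ℂ) (γ : ℝ → ℂ) : ℝ≥0∞ :=
  ∫⁻ t in Ioo (0 : ℝ) 1, ENNReal.ofReal (Real.sqrt (flatForm F G (γ t) (deriv γ t)))

/-- Completeness at `0` on the punctured disk of radius `ε`: every `C¹` path `[0, 1) → PDisk ε`
that accumulates to `0` has infinite length with respect to the flat fundamental form. -/
def CompleteAtZero (ε : ℝ) (F G : ℂ → ℂ) : Prop :=
  ∀ γ : ℝ → ℂ, ContDiffOn ℝ 1 γ (Ico 0 1) → MapsTo γ (Ico 0 1) (PDisk ε) →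
    MapClusterPt 0 (𝓝[<] (1 : ℝ)) γ → flatLength F G γ = ⊤

/-- `ψ` restricted to the open set `U` is a smooth embedding. -/
def IsEmbeddingOn (ψ : ℂ → Space) (U : Set ℂ) : Prop :=
  ContDiffOn ℝ ∞ ψ U ∧ (∀ z ∈ U, Function.Injective (fderiv ℝ ψ z)) ∧
    IsEmbedding (U.domRestrict ψ)

/-- The end `0` of `ψ : PDisk ε → ℂ × ℝ` is embedded. -/
def IsEmbeddedEnd (ε : ℝ) (ψ : ℂ → Space) : Prop :=
  ∃ δ : ℝ, 0 < δ ∧ δ ≤ ε ∧ IsEmbeddingOn ψ (PDisk δ)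

/-- `ψ'`, on the punctured disk of radius `δ`, is a piece, complete at `0`, of the improper affine
front on `ℂ \ {0}` with Weierstrass data `(F₀, G₀)`: up to a parallel translation it is that front
precomposed with an injective holomorphic map (a conformal change of the parameter). -/
def IsPieceCompleteAtZero (F₀ G₀ : ℂ → ℂ) (δ : ℝ) (ψ' : ℂ → Space) : Prop :=
  ∃ (Ψ : ℂ → Space) (φ : ℂ → ℂ) (v : Space),
    IsImproperAffineFront {0}ᶜ F₀ G₀ Ψ ∧
    DifferentiableOn ℂ φ (PDisk δ) ∧ InjOn φ (PDisk δ) ∧ MapsTo φ (PDisk δ) {0}ᶜ ∧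
    (∀ z ∈ PDisk δ, ψ' z = Ψ (φ z) + v) ∧
    CompleteAtZero δ (F₀ ∘ φ) (G₀ ∘ φ)

/-- `ψ : PDisk ε → ℂ × ℝ` is asymptotic, with error `o(1)` in Euclidean norm as `z → 0`, to a piece
of the front with Weierstrass data `(F₀, G₀)`. -/
def IsAsymptoticToPiece (ε : ℝ) (ψ : ℂ → Space) (F₀ G₀ : ℂ → ℂ) : Prop :=
  ∃ (δ : ℝ) (ψ' : ℂ → Space), 0 < δ ∧ δ ≤ ε ∧ IsPieceCompleteAtZero F₀ G₀ δ ψ' ∧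
    Tendsto (fun z => ‖ψ z - ψ' z‖) (𝓝[≠] 0) (𝓝 0)

/-- As `IsAsymptoticToPiece`, where the model front is taken up to interchanging its two Weierstrass
data, which amounts to the half-turn `(x₁, x₂, x₃) ↦ (x₁, -x₂, -x₃)` of `ℝ³`. -/
def IsAsymptoticToModel (ε : ℝ) (ψ : ℂ → Space) (F₀ G₀ : ℂ → ℂ) : Prop :=
  IsAsymptoticToPiece ε ψ F₀ G₀ ∨ IsAsymptoticToPiece ε ψ G₀ F₀

/-- Asymptotic to a type-P end: the model is an elliptic paraboloid. -/
def IsAsymptoticTypeP (ε : ℝ) (ψ : ℂ → Space) : Prop :=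
  ∃ b : ℂ, ‖b‖ ≠ 1 ∧ IsAsymptoticToModel ε ψ (fun z => 1 / z) (fun z => b / z)

/-- Asymptotic to a type-R end: the model is a rotational improper affine front. -/
def IsAsymptoticTypeR (ε : ℝ) (ψ : ℂ → Space) : Prop :=
  ∃ a : ℝ, a ≠ 0 ∧ IsAsymptoticToModel ε ψ (fun z => 1 / z) (fun z => a * z)

/-- Asymptotic to a type-NR end: the model is a non-rotational improper affine front. -/
def IsAsymptoticTypeNR (ε : ℝ) (ψ : ℂ → Space) : Prop :=
  ∃ (a : ℝ) (b : ℂ), a ≠ 0 ∧ b ≠ 0 ∧ ‖b‖ ≠ 1 ∧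
    IsAsymptoticToModel ε ψ (fun z => 1 / z) (fun z => a * z + b / z)

end ImproperAffine

/-! The punctured disk is connected and the affine metric never degenerates, so |dF| < |dG|
throughout or |dG| < |dF| throughout. The half-turn interchanges F and G and preserves both sides of
the equivalence, so one may assume |dF| < |dG|. Then ds ≤ 2|dG|, hence the flat metric |dG|² is
complete at 0, and this forces G to have a pole, of some order n (`tendsto_cobounded_of_complete`).
The quotient dF/dG is bounded by 1, so it extends across 0, and by the maximum principle its value b
there satisfies |b| < 1; consequently F = bG + o(z⁻ⁿ) (`exists_normal_form`). Both sides of the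
equivalence turn out to mean n = 1.

Embeddedness. The planar part f = G + conj F is a local homeomorphism that winds n times around
infinity. Lift many turns of a large circle through f. If the height never agreed at two points of
the lift one turn apart, it would be strictly monotone along a finite fibre. So it agrees somewhere,
injectivity closes the lift after a single turn, and n = 1 (`pole_order_eq_one_of_injOn`).
Conversely, if n = 1, then F - bG is holomorphic at 0 and |b| < 1 makes f injective near 0
(`exists_injOn_planar`).

Asymptotics. An injective change of parameter that tends to 0 or ∞ does so to first order, and the
planar part of a model grows at most like |w|⁻¹ + |w|, so an end asymptotic to a model has n = 1
(`pole_order_eq_one_of_asymptotic`). Conversely, if n = 1, write F = bG + k and G = e/z. The period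
condition makes a = k'(0)e(0) real, and in the coordinate φ = 1/(G + d), with a suitable constant d,
the data are those of the model (aw + b/w, 1/w) up to constants and an error O(z²), too small to be
felt against simple poles (`exists_isAsymptoticToPiece`). -/

namespace ImproperAffine

/-! ### Lifting paths through a local homeomorphism -/

section Lifting

theorem continuousOn_update_of_tendsto {E : Type*} [TopologicalSpace E] {T : ℝ} (hT : 0 < T)
    {γ : ℝ → E} (hγ : ContinuousOn γ (Ico 0 T)) {e : E} (he : Tendsto γ (𝓝[<] T) (𝓝 e)) :
    ContinuousOn (Function.update γ T e) (Icc 0 T) := by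
  rw [continuousOn_update_iff, Icc_sdiff_right, nhdsWithin_Ico_eq_nhdsLT hT]
  exact ⟨hγ, fun _ => he⟩

variable {E X ι : Type*} [TopologicalSpace E] [TopologicalSpace X] [T2Space E]
  {p : E → X}

/-- Two lifts through a local homeomorphism that agree at one point of a preconnected set
agree on it. -/
theorem eqOn_of_lifts (hp : IsLocalHomeomorph p) {s : Set ℝ} (hs : IsPreconnected s)
    {g₁ g₂ : ℝ → E} (h₁ : ContinuousOn g₁ s) (h₂ : ContinuousOn g₂ s)
    (he : ∀ t ∈ s, p (g₁ t) = p (g₂ t)) {a : ℝ} (ha : a ∈ s) (hga : g₁ a = g₂ a) : EqOn g₁ g₂ s :=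
  (T2Space.isSeparatedMap p).eqOn_of_comp_eqOn hp.isLocallyInjective hs h₁ h₂ he ha hga

/-- A lift on `[0, T)` that stays in a compact set converges at `T`. -/
theorem exists_tendsto_lift [T2Space X] (hp : IsLocalHomeomorph p) {σ : ℝ → X} (hσ : Continuous σ) {T : ℝ}
    (hT : 0 < T) {γ : ℝ → E} (hγ : ContinuousOn γ (Ico 0 T)) (hl : ∀ t ∈ Ico 0 T, p (γ t) = σ t)
    {K : Set E} (hK : IsCompact K) (hγK : ∀ᶠ t in 𝓝[<] T, γ t ∈ K) :
    ∃ e, Tendsto γ (𝓝[<] T) (𝓝 e) := by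
  obtain ⟨e, -, he⟩ := hK (f := map γ (𝓝[<] T)) (le_principal_iff.2 hγK)
  have hne : (𝓝[<] T ⊓ comap γ (𝓝 e)).NeBot := by
    have h2 : (𝓝 e ⊓ map γ (𝓝[<] T)).NeBot := he
    rwa [inf_comm, ← Filter.push_pull, map_neBot_iff] at h2
  have hev : ∀ᶠ t in 𝓝[<] T, t ∈ Ico 0 T := by
    filter_upwards [Ioo_mem_nhdsLT hT] with t ht using ⟨ht.1.le, ht.2⟩
  have hpe : p e = σ T := by
    have h1 : Tendsto (p ∘ γ) (𝓝[<] T ⊓ comap γ (𝓝 e)) (𝓝 (p e)) :=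
      (hp.continuous.tendsto e).comp (tendsto_comap.mono_left inf_le_right)
    have h2 : Tendsto (p ∘ γ) (𝓝[<] T ⊓ comap γ (𝓝 e)) (𝓝 (σ T)) :=
      (((hσ.tendsto T).mono_left nhdsWithin_le_nhds).congr'
        (by filter_upwards [hev] with t ht using (hl t ht).symm)).mono_left inf_le_left
    exact tendsto_nhds_unique h1 h2
  obtain ⟨q, heq, rfl⟩ := hp e
  have hW : ∀ᶠ t in 𝓝[<] T, σ t ∈ q.target :=
    (hσ.tendsto T).mono_left nhdsWithin_le_nhds
      (q.open_target.mem_nhds (hpe ▸ q.map_source heq))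
  obtain ⟨a, haT, ha⟩ := (mem_nhdsLT_iff_exists_Ioo_subset).1 (hW.and hev)
  have hfr : ∃ᶠ t in 𝓝[<] T, γ t ∈ q.source :=
    (mapClusterPt_iff_frequently.1 he) _ (q.open_source.mem_nhds heq)
  obtain ⟨b, hb, hbI⟩ := (hfr.and_eventually (Ioo_mem_nhdsLT haT)).exists
  -- Near `T` the lift is a local section composed with `σ`: the two agree at a time `b` when `γ`
  -- visits `q.source`, and the section is continuous up to `T`.
  have key : EqOn γ (q.symm ∘ σ) (Ioo a T) := by
    refine eqOn_of_lifts hp isPreconnected_Ioo (hγ.mono fun t ht => (ha ht).2)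
      (q.continuousOn_symm.comp hσ.continuousOn fun t ht => (ha ht).1) (fun t ht => ?_) hbI ?_
    · rw [hl t (ha ht).2, Function.comp, q.right_inv (ha ht).1]
    · rw [Function.comp, ← hl b (ha hbI).2, q.left_inv hb]
  refine ⟨e, ?_⟩
  have h3 : Tendsto (q.symm ∘ σ) (𝓝[<] T) (𝓝 e) := by
    have := (q.tendsto_symm heq)
    rw [hpe] at this
    exact this.comp ((hσ.tendsto T).mono_left nhdsWithin_le_nhds)
  refine h3.congr' ?_
  filter_upwards [Ioo_mem_nhdsLT haT] with t ht using (key ht).symm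

/-- If every lift on a half-open interval converges at its end, the path lifts to `[0, 1]`. -/
theorem exists_lift [T2Space X] (hp : IsLocalHomeomorph p) {σ : ℝ → X} (hσ : Continuous σ) {e₀ : E}
    (he₀ : p e₀ = σ 0)
    (H : ∀ T ∈ Ioc (0 : ℝ) 1, ∀ γ : ℝ → E, ContinuousOn γ (Ico 0 T) → γ 0 = e₀ →
      (∀ t ∈ Ico 0 T, p (γ t) = σ t) → ∃ e, Tendsto γ (𝓝[<] T) (𝓝 e)) :
    ∃ γ : ℝ → E, ContinuousOn γ (Icc 0 1) ∧ γ 0 = e₀ ∧ ∀ t ∈ Icc (0 : ℝ) 1, p (γ t) = σ t := by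
  let L : ℝ → (ℝ → E) → Prop := fun T γ =>
    ContinuousOn γ (Icc 0 T) ∧ γ 0 = e₀ ∧ ∀ t ∈ Icc 0 T, p (γ t) = σ t
  -- Continuity method: `hext` shows that the set of reachable times is open, and `H` that its
  -- supremum is reached.
  let S : Set ℝ := {T | T ∈ Icc (0 : ℝ) 1 ∧ ∃ γ, L T γ}
  have hL : ∀ {T T' : ℝ} {γ : ℝ → E}, T ≤ T' → L T' γ → L T γ := fun hTT h =>
    ⟨h.1.mono (Icc_subset_Icc_right hTT), h.2.1, fun t ht => h.2.2 t ⟨ht.1, ht.2.trans hTT⟩⟩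
  have huniq : ∀ {T : ℝ} {γ γ' : ℝ → E}, 0 ≤ T → L T γ → L T γ' → EqOn γ γ' (Icc 0 T) :=
    fun hT h h' => eqOn_of_lifts hp isPreconnected_Icc h.1 h'.1
      (fun t ht => (h.2.2 t ht).trans (h'.2.2 t ht).symm) (left_mem_Icc.2 hT)
      (h.2.1.trans h'.2.1.symm)
  -- extension beyond a given time
  have hext : ∀ T, 0 ≤ T → (∃ γ, L T γ) → ∃ T' > T, ∃ γ, L T' γ := by
    rintro T hT ⟨γ, hγ⟩
    obtain ⟨q, hq, rfl⟩ := hp (γ T)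
    have hT' : T ∈ Icc 0 T := ⟨hT, le_rfl⟩
    have hW : ∀ᶠ t in 𝓝 T, σ t ∈ q.target := hσ.tendsto T
      (q.open_target.mem_nhds (hγ.2.2 T hT' ▸ q.map_source hq))
    obtain ⟨η, hη, hball⟩ := Metric.eventually_nhds_iff.1 hW
    have htar : ∀ t ∈ Icc T (T + η / 2), σ t ∈ q.target := fun t ht => hball (by
      rw [Real.dist_eq, abs_lt]; constructor <;> linarith [ht.1, ht.2])
    have hTs : q.symm (σ T) = γ T := by rw [← hγ.2.2 T hT', q.left_inv hq]
    refine ⟨T + η / 2, by linarith, fun t => if t ≤ T then γ t else q.symm (σ t), ?_, ?_, ?_⟩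
    · refine ContinuousOn.if (fun t ht => ?_) (hγ.1.mono fun t ht => ?_)
        ((q.continuousOn_symm.comp hσ.continuousOn htar).mono fun t ht => ?_)
      · have : t = T := frontier_Iic_subset T ht.2
        rw [this, hTs]
      · have : closure {a : ℝ | a ≤ T} = Iic T := isClosed_Iic.closure_eq
        rw [this] at ht
        exact ⟨ht.1.1, ht.2⟩
      · have : closure {a : ℝ | ¬ a ≤ T} ⊆ Ici T := by
          refine closure_minimal (fun a ha => ?_) isClosed_Ici
          exact (not_le.1 ha).le
        exact ⟨this ht.2, ht.1.2⟩
    · simp [hT, hγ.2.1]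
    · intro t ht
      by_cases h : t ≤ T
      · simp only [h, if_true]; exact hγ.2.2 t ⟨ht.1, h⟩
      · simp only [h, if_false]; exact q.right_inv (htar t ⟨(not_le.1 h).le, ht.2⟩)
  have h0 : (0 : ℝ) ∈ S := ⟨⟨le_rfl, zero_le_one⟩, fun _ => e₀, continuousOn_const, rfl, fun t ht => by
    obtain rfl : t = 0 := le_antisymm ht.2 ht.1
    exact he₀⟩
  have hbdd : BddAbove S := ⟨1, fun T hT => hT.1.2⟩
  set T := sSup S with hTdef
  have hT0 : 0 < T := by
    obtain ⟨T', hT', γ, hγ⟩ := hext 0 le_rfl h0.2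
    exact (lt_min hT' zero_lt_one).trans_le (le_csSup hbdd (a := min T' 1)
      ⟨⟨le_min hT'.le zero_le_one, min_le_right _ _⟩, γ, hL (min_le_left _ _) hγ⟩)
  have hT1 : T ≤ 1 := csSup_le ⟨0, h0⟩ fun T hT => hT.1.2
  have hlt : ∀ t < T, ∃ γ, L t γ := fun t ht => by
    obtain ⟨T', hT', htT'⟩ := exists_lt_of_lt_csSup ⟨0, h0⟩ ht
    exact hT'.2.imp fun γ hγ => hL htT'.le hγ
  have : Nonempty (ℝ → E) := ⟨fun _ => e₀⟩
  choose! Γ hΓ using hlt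
  -- By uniqueness the partial lifts `Γ t` agree where they overlap, so the diagonal is a lift on
  -- all of `[0, T)`.
  let γ : ℝ → E := fun t => Γ t t
  have hγΓ : ∀ t ∈ Ico 0 T, ∀ s ∈ Icc 0 t, γ s = Γ t s := fun t ht s hs =>
    huniq hs.1 (hΓ s (hs.2.trans_lt ht.2)) (hL hs.2 (hΓ t ht.2)) ⟨hs.1, le_rfl⟩
  have hγc : ContinuousOn γ (Ico 0 T) := by
    intro t ht
    obtain ⟨u, htu, huT⟩ := exists_between ht.2
    have h1 : ContinuousWithinAt (Γ u) (Icc 0 u) t :=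
      (hΓ u huT).1 t ⟨ht.1, htu.le⟩
    have h2 : ContinuousWithinAt γ (Icc 0 u) t :=
      h1.congr (fun s hs => hγΓ u ⟨ht.1.trans htu.le, huT⟩ s hs)
        (hγΓ u ⟨ht.1.trans htu.le, huT⟩ t ⟨ht.1, htu.le⟩)
    refine h2.mono_of_mem_nhdsWithin ?_
    filter_upwards [self_mem_nhdsWithin, mem_nhdsWithin_of_mem_nhds (Iio_mem_nhds htu)] with s hs hsu
    exact ⟨hs.1, hsu.le⟩
  have hγ0 : γ 0 = e₀ := (hΓ 0 hT0).2.1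
  have hγl : ∀ t ∈ Ico 0 T, p (γ t) = σ t := fun t ht => (hΓ t ht.2).2.2 t ⟨ht.1, le_rfl⟩
  obtain ⟨e, he⟩ := H T ⟨hT0, hT1⟩ γ hγc hγ0 hγl
  have hLT : ∃ γ, L T γ := by
    refine ⟨Function.update γ T e, ?_, ?_, ?_⟩
    · exact continuousOn_update_of_tendsto hT0 hγc he
    · rw [Function.update_of_ne hT0.ne, hγ0]
    · intro t ht
      rcases ht.2.lt_or_eq with h | rfl
      · rw [Function.update_of_ne h.ne]; exact hγl t ⟨ht.1, h⟩
      · rw [Function.update_self]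
        refine tendsto_nhds_unique ((hp.continuous.tendsto e).comp he)
          (((hσ.tendsto T).mono_left nhdsWithin_le_nhds).congr' ?_)
        filter_upwards [Ioo_mem_nhdsLT hT0] with s hs using (hγl s ⟨hs.1.le, hs.2⟩).symm
  rcases hT1.lt_or_eq with h | h
  · obtain ⟨T', hT', γ', hγ'⟩ := hext T hT0.le hLT
    exact absurd (le_csSup hbdd (a := min T' 1)
      ⟨⟨le_min (hT0.le.trans hT'.le) zero_le_one, min_le_right _ _⟩, γ', hL (min_le_left _ _) hγ'⟩)
      (not_le.2 (lt_min hT' h))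
  · rw [h] at hLT
    exact hLT

/-- Lifts of a converging family of paths converge pointwise, provided their origins do and the
limit path lifts. -/
theorem tendsto_lift (hp : IsLocalHomeomorph p) {l : Filter ι} {s : Set ℝ} (hs : s.OrdConnected)
    {σ : ι → ℝ → X} {σ₀ : ℝ → X}
    (hσ : ∀ i, Continuous (σ i))
    (hσl : ∀ t, Tendsto (fun q : ι × ℝ => σ q.1 q.2) (l ×ˢ 𝓝 t) (𝓝 (σ₀ t)))
    {γ : ι → ℝ → E} {γ₀ : ℝ → E} (hγ : ∀ i, ContinuousOn (γ i) s) (hγ₀ : ContinuousOn γ₀ s)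
    (hl : ∀ i, ∀ t ∈ s, p (γ i t) = σ i t) (hl₀ : ∀ t ∈ s, p (γ₀ t) = σ₀ t)
    {a b : ℝ} (ha : a ∈ s) (hb : b ∈ s) (h : Tendsto (fun i => γ i a) l (𝓝 (γ₀ a))) :
    Tendsto (fun i => γ i b) l (𝓝 (γ₀ b)) := by
  have hσp : ∀ t, Tendsto (fun i => σ i t) l (𝓝 (σ₀ t)) := fun t =>
    (hσl t).comp (tendsto_id.prodMk tendsto_const_pure |>.mono_right
      (prod_mono_right _ (pure_le_nhds t)))
  -- Convergence at one time near `t` is equivalent to convergence at any other: the lifts are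
  -- eventually the same local section composed with `σ i`. Connectedness of `s` then carries it
  -- from `a` to `b`.
  have key : ∀ t ∈ s, ∃ v ∈ 𝓝[s] t, ∀ x ∈ v, ∀ y ∈ v, Tendsto (fun i => γ i x) l (𝓝 (γ₀ x)) →
      Tendsto (fun i => γ i y) l (𝓝 (γ₀ y)) := by
    intro t ht
    obtain ⟨q, hq, rfl⟩ := hp (γ₀ t)
    have h1 : ∀ᶠ w in l ×ˢ 𝓝 t, σ w.1 w.2 ∈ q.target :=
      hσl t (q.open_target.mem_nhds (hl₀ t ht ▸ q.map_source hq))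
    obtain ⟨P, hP, Q, hQ, hPQ⟩ := eventually_prod_iff.1 h1
    have h2 : ∀ᶠ x in 𝓝[s] t, γ₀ x ∈ q.source := hγ₀ t ht (q.open_source.mem_nhds hq)
    obtain ⟨v, hv, hvu, hvs, hvc⟩ : ∃ v ∈ 𝓝[s] t, v ⊆ {x | γ₀ x ∈ q.source} ∩ {x | Q x} ∧ v ⊆ s ∧
        IsPreconnected v := by
      obtain ⟨η, hη, h3⟩ := Metric.mem_nhdsWithin_iff.1
        (inter_mem h2 (mem_nhdsWithin_of_mem_nhds hQ))
      refine ⟨Metric.ball t η ∩ s, inter_comm s _ ▸ inter_mem_nhdsWithin _ (Metric.ball_mem_nhds t hη),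
        h3, inter_subset_right, ?_⟩
      rw [Real.ball_eq_Ioo]
      exact (ordConnected_Ioo.inter hs).isPreconnected
    refine ⟨v, hv, fun x hx y hy hx' => ?_⟩
    have h3 : ∀ᶠ i in l, γ i y = q.symm (σ i y) := by
      filter_upwards [hP, hx' (q.open_source.mem_nhds (hvu hx).1)] with i hi hix
      refine eqOn_of_lifts hp hvc ((hγ i).mono hvs)
        (q.continuousOn_symm.comp (hσ i).continuousOn fun z hz => hPQ hi (hvu hz).2)
        (fun z hz => ?_) hx ?_ hy
      · rw [hl i z (hvs hz), Function.comp, q.right_inv (hPQ hi (hvu hz).2)]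
      · rw [Function.comp, ← hl i x (hvs hx), q.left_inv hix]
    have h4 := (q.tendsto_symm (hvu hy).1)
    rw [hl₀ y (hvs hy)] at h4
    refine (h4.comp (hσp y)).congr' ?_
    filter_upwards [h3] with i hi using hi.symm
  refine (hs.isPreconnected.induction₂ (fun x y => Tendsto (fun i => γ i x) l (𝓝 (γ₀ x)) ↔
      Tendsto (fun i => γ i y) l (𝓝 (γ₀ y))) (fun x hx => ?_) (fun x y z _ _ _ h h' => h.trans h')
      (fun x y _ _ h => h.symm) ha hb).1 h
  obtain ⟨v, hv, hvv⟩ := key x hx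
  filter_upwards [hv] with y hy
  have hxv := mem_of_mem_nhdsWithin hx hv
  exact ⟨hvv x hxv y hy, hvv y hy x hxv⟩

end Lifting

/-! ### The punctured disk -/

section PuncturedDisk

theorem pdisk_eq (ε : ℝ) : PDisk ε = Metric.ball 0 ε \ {0} := by
  ext z; simp [PDisk, and_comm]

theorem isOpen_pdisk (ε : ℝ) : IsOpen (PDisk ε) := by
  rw [pdisk_eq]; exact Metric.isOpen_ball.sdiff isClosed_singleton

theorem pdisk_mem_nhdsNE {ε : ℝ} (hε : 0 < ε) : PDisk ε ∈ 𝓝[≠] (0 : ℂ) := by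
  rw [pdisk_eq, sdiff_eq, inter_comm]
  exact inter_mem_nhdsWithin _ (Metric.ball_mem_nhds 0 hε)

theorem pdisk_mono {δ ε : ℝ} (h : δ ≤ ε) : PDisk δ ⊆ PDisk ε := fun _ hz => ⟨hz.1, hz.2.trans_le h⟩

theorem exists_pdisk_of_eventually {P : ℂ → Prop} (h : ∀ᶠ z in 𝓝[≠] (0 : ℂ), P z) {ε : ℝ}
    (hε : 0 < ε) : ∃ δ, 0 < δ ∧ δ ≤ ε ∧ ∀ z ∈ PDisk δ, P z := by
  obtain ⟨δ, hδ, hP⟩ := Metric.mem_nhdsWithin_iff.1 h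
  exact ⟨min δ ε, lt_min hδ hε, min_le_right _ _, fun z hz =>
    hP ⟨by simpa using hz.2.trans_le (min_le_left _ _), by simpa using hz.1⟩⟩

theorem isPreconnected_pdisk (ε : ℝ) : IsPreconnected (PDisk ε) := by
  have h : PDisk ε = (fun q : ℝ × ℝ => (q.1 : ℂ) * Complex.exp (q.2 * Complex.I)) ''
      (Ioo 0 ε ×ˢ univ) := by
    ext z
    constructor
    · intro hz
      exact ⟨(‖z‖, z.arg), ⟨hz, mem_univ _⟩, by simp⟩
    · rintro ⟨⟨r, θ⟩, ⟨hr, -⟩, rfl⟩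
      simp only [PDisk, mem_ofPred, norm_mul, Complex.norm_real, Complex.norm_exp_ofReal_mul_I, mul_one,
        Real.norm_eq_abs, abs_of_pos hr.1]
      exact hr
  rw [h]
  exact (isPreconnected_Ioo.prod isPreconnected_univ).image _ (by fun_prop)

end PuncturedDisk

/-! ### Local inverses of holomorphic functions -/

section LocalInverse

theorem isLocalHomeomorph_domRestrict {f : ℂ → ℂ} {U : Set ℂ} (hU : IsOpen U)
    (hf : IsLocalHomeomorphOn f U) : IsLocalHomeomorph (fun z : U => f z) := by
  rw [isLocalHomeomorph_iff_isLocalHomeomorphOn_univ]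
  exact hf.comp (isLocalHomeomorph_iff_isLocalHomeomorphOn_univ.1
    hU.isOpenEmbedding_subtypeVal.isLocalHomeomorph) fun z _ => z.2

theorem isLocalHomeomorphOn_of_deriv_ne_zero {G : ℂ → ℂ} {U : Set ℂ} (hU : IsOpen U)
    (hG : DifferentiableOn ℂ G U) (hG' : ∀ z ∈ U, deriv G z ≠ 0) : IsLocalHomeomorphOn G U := by
  intro z hz
  have h := ((hG.analyticAt (hU.mem_nhds hz)).hasStrictDerivAt).hasStrictFDerivAt_equiv (hG' z hz)
  exact ⟨h.toOpenPartialHomeomorph G, h.mem_toOpenPartialHomeomorph_source, rfl⟩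

/-- Serves to show that continuous lifts through `G` are C¹ and that the coordinate `φ` built at a
simple pole is injective. -/
theorem exists_contDiffAt_leftInverse {G : ℂ → ℂ} {z : ℂ} (hG : AnalyticAt ℂ G z)
    (hG' : deriv G z ≠ 0) :
    ∃ s : ℂ → ℂ, ContDiffAt ℂ ω s (G z) ∧ ∀ᶠ x in 𝓝 z, s (G x) = x := by
  have h := hG.hasStrictDerivAt.hasStrictFDerivAt_equiv hG'
  let q := h.toOpenPartialHomeomorph G
  have hz : z ∈ q.source := h.mem_toOpenPartialHomeomorph_source
  refine ⟨q.symm, ?_, ?_⟩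
  · refine q.contDiffAt_symm_deriv hG' (q.map_source hz) ?_ ?_
    · rw [show q.symm (G z) = z from q.left_inv hz]; exact hG.differentiableAt.hasDerivAt
    · rw [show q.symm (G z) = z from q.left_inv hz]; exact hG.contDiffAt
  · filter_upwards [q.open_source.mem_nhds hz] with x hx using q.left_inv hx

end LocalInverse

/-! ### Completeness and lifts of straight segments -/

section Length

/-- Where |dF| ≤ |dG| this gives ds ≤ 2|dG|, so completeness passes to the metric |dG|². -/
theorem flatForm_le (F G : ℂ → ℂ) (z v : ℂ) :
    flatForm F G z v ≤ (‖deriv F z * v‖ + ‖deriv G z * v‖) ^ 2 := by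
  have h : (deriv F z * v * (deriv G z * v)).re ≤ ‖deriv F z * v‖ * ‖deriv G z * v‖ :=
    (Complex.re_le_norm _).trans_eq (norm_mul _ _)
  unfold flatForm
  nlinarith

variable {ε : ℝ} {F G : ℂ → ℂ}

/-- A lift through `G` of a straight segment cannot accumulate at the complete end. -/
theorem not_mapClusterPt_lift (hG : DifferentiableOn ℂ G (PDisk ε))
    (hlt : ∀ z ∈ PDisk ε, ‖deriv F z‖ < ‖deriv G z‖) (hc : CompleteAtZero ε F G)
    {T : ℝ} (hT : 0 < T) {γ : ℝ → ℂ} (hγ : ContinuousOn γ (Ico 0 T))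
    (hmaps : MapsTo γ (Ico 0 T) (PDisk ε)) {A v : ℂ}
    (hl : ∀ t ∈ Ico 0 T, G (γ t) = A + t * v) : ¬ MapClusterPt 0 (𝓝[<] T) γ := by
  intro hcl
  have hG' : ∀ z ∈ PDisk ε, deriv G z ≠ 0 := fun z hz h0 => by
    have := hlt z hz
    rw [h0, norm_zero] at this
    exact absurd (norm_nonneg _) (not_le.2 this)
  have hGa : ∀ z ∈ PDisk ε, AnalyticAt ℂ G z := fun z hz =>
    hG.analyticAt ((isOpen_pdisk ε).mem_nhds hz)
  -- Rescaled to `[0, 1)`, the parameter interval used in `CompleteAtZero`.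
  let β : ℝ → ℂ := fun t => γ (T * t)
  have hm : MapsTo (fun t : ℝ => T * t) (Ico 0 1) (Ico 0 T) := fun t ht =>
    ⟨mul_nonneg hT.le ht.1, by nlinarith [ht.2]⟩
  have hβc : ContinuousOn β (Ico 0 1) := hγ.comp (by fun_prop) hm
  have hβm : MapsTo β (Ico 0 1) (PDisk ε) := hmaps.comp hm
  have hβl : ∀ t ∈ Ico (0 : ℝ) 1, G (β t) = A + (T * t : ℝ) * v := fun t ht => hl _ (hm ht)
  have hβ : ContDiffOn ℝ 1 β (Ico 0 1) := by
    intro t ht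
    obtain ⟨s, hs, hinv⟩ := exists_contDiffAt_leftInverse (hGa _ (hβm ht)) (hG' _ (hβm ht))
    have h1 : ∀ᶠ u in 𝓝[Ico 0 1] t, s (A + (T * u : ℝ) * v) = β u := by
      filter_upwards [hβc t ht hinv, self_mem_nhdsWithin] with u hu huI
      rw [← hβl u huI]; exact hu
    have h2 : ContDiffAt ℝ 1 s (A + (T * t : ℝ) * v) := by
      rw [← hβl t ht]; exact (hs.restrict_scalars ℝ).of_le (by simp)
    have h3 : ContDiffAt ℝ 1 (fun u : ℝ => s (A + (T * u : ℝ) * v)) t :=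
      ContDiffAt.comp t h2 (by
        have : ContDiff ℝ 1 (fun u : ℝ => ((T * u : ℝ) : ℂ)) :=
          Complex.ofRealCLM.contDiff.comp (contDiff_const.mul contDiff_id)
        exact (contDiff_const.add (this.mul contDiff_const)).contDiffAt)
    refine h3.contDiffWithinAt.congr_of_eventuallyEq ?_ (h1.self_of_nhdsWithin ht).symm
    filter_upwards [h1] with u hu using hu.symm
  have hβcl : MapClusterPt 0 (𝓝[<] (1 : ℝ)) β := by
    have hmap : map (fun t : ℝ => T * t) (𝓝[<] (1 : ℝ)) = 𝓝[<] T := by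
      have := (Homeomorph.mulLeft₀ T hT.ne').isEmbedding.map_nhdsWithin_eq (Iio 1) 1
      simpa [image_mul_left_Iio hT] using this
    rw [MapClusterPt, ← hmap, map_map] at hcl
    exact hcl
  have htop := hc β hβ hβm hβcl
  -- `G ∘ β` has constant velocity `T * v`, so `β` has |dG|-length `‖T * v‖`, and its flat length is
  -- at most twice that.
  have hle : flatLength F G β ≤ ENNReal.ofReal (2 * ‖T * v‖) := by
    unfold flatLength
    calc _ ≤ ∫⁻ _ in Ioo (0 : ℝ) 1, ENNReal.ofReal (2 * ‖T * v‖) := by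
          refine setLIntegral_mono measurable_const fun t ht => ENNReal.ofReal_le_ofReal ?_
          have htI : t ∈ Ico (0 : ℝ) 1 := ⟨ht.1.le, ht.2⟩
          have hnh : Ico (0 : ℝ) 1 ∈ 𝓝 t := Ico_mem_nhds ht.1 ht.2
          have hd : HasDerivAt β (deriv β t) t :=
            ((hβ.contDiffAt hnh).differentiableAt (by simp)).hasDerivAt
          have hd1 : HasDerivAt (fun u => G (β u)) (deriv G (β t) * deriv β t) t :=
            (hGa _ (hβm htI)).differentiableAt.hasDerivAt.comp t hd
          have hd2 : HasDerivAt (fun u => G (β u)) (T * v) t := by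
            have h5 : HasDerivAt (fun u : ℝ => A + (T * u : ℝ) * v) (T * v) t := by
              have h6 : HasDerivAt (fun u : ℝ => ((T * u : ℝ) : ℂ)) ((T * 1 : ℝ) : ℂ) t :=
                ((hasDerivAt_id t).const_mul T).ofReal_comp
              simpa using (h6.mul_const v).const_add A
            refine h5.congr_of_eventuallyEq ?_
            filter_upwards [hnh] with u hu using hβl u hu
          have heq := hd1.unique hd2
          have hF : ‖deriv F (β t) * deriv β t‖ ≤ ‖T * v‖ := by
            rw [← heq, norm_mul, norm_mul]
            exact mul_le_mul_of_nonneg_right (hlt _ (hβm htI)).le (norm_nonneg _)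
          refine Real.sqrt_le_iff.2 ⟨by positivity, (flatForm_le F G _ _).trans ?_⟩
          rw [heq]
          gcongr
          linarith
      _ = _ := by simp
  rw [htop] at hle
  exact ENNReal.ofReal_ne_top (top_le_iff.1 hle)

end Length

/-! ### Completeness makes `G` tend to infinity -/

section Pole

variable {ε : ℝ} {F G : ℂ → ℂ}

theorem isCompact_annulus {ε η r : ℝ} (hη : 0 < η) (hr : r < ε) :
    IsCompact {x : PDisk ε | η ≤ ‖(x : ℂ)‖ ∧ ‖(x : ℂ)‖ ≤ r} := by
  rw [Topology.IsEmbedding.subtypeVal.isCompact_iff]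
  have : Subtype.val '' {x : PDisk ε | η ≤ ‖(x : ℂ)‖ ∧ ‖(x : ℂ)‖ ≤ r} =
      Metric.closedBall 0 r ∩ {z | η ≤ ‖z‖} := by
    ext z
    constructor
    · rintro ⟨x, hx, rfl⟩
      exact ⟨by simpa using hx.2, hx.1⟩
    · rintro ⟨h1, h2⟩
      have h1' : ‖z‖ ≤ r := by simpa using h1
      exact ⟨⟨z, hη.trans_le h2, h1'.trans_lt hr⟩, ⟨h2, h1'⟩, rfl⟩
  rw [this]
  exact (isCompact_closedBall 0 r).inter_right (isClosed_le continuous_const continuous_norm)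

/-- A lift of a segment that stays in a closed punctured disk converges. -/
theorem exists_tendsto_segment_lift (hG : DifferentiableOn ℂ G (PDisk ε))
    (hlt : ∀ z ∈ PDisk ε, ‖deriv F z‖ < ‖deriv G z‖) (hc : CompleteAtZero ε F G)
    (hp : IsLocalHomeomorph (fun z : PDisk ε => G z)) {r : ℝ} (hr : r < ε)
    {T : ℝ} (hT : 0 < T) {γ : ℝ → PDisk ε} (hγ : ContinuousOn γ (Ico 0 T)) {A v : ℂ}
    (hl : ∀ t ∈ Ico 0 T, G (γ t) = A + t * v) (hγr : ∀ t ∈ Ico 0 T, ‖(γ t : ℂ)‖ ≤ r) :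
    ∃ e, Tendsto γ (𝓝[<] T) (𝓝 e) := by
  have h := not_mapClusterPt_lift hG hlt hc hT (γ := fun t => (γ t : ℂ))
    (continuous_subtype_val.comp_continuousOn hγ) (fun t _ => (γ t).2) hl
  rw [mapClusterPt_iff_frequently] at h
  push Not at h
  obtain ⟨s, hs, hsf⟩ := h
  obtain ⟨η, hη, hηs⟩ := Metric.mem_nhds_iff.1 hs
  refine exists_tendsto_lift hp (σ := fun t : ℝ => A + t * v) (by fun_prop) hT hγ hl
    (isCompact_annulus hη hr) ?_
  filter_upwards [hsf, Ioo_mem_nhdsLT hT] with t ht htI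
  refine ⟨?_, hγr t ⟨htI.1.le, htI.2⟩⟩
  by_contra hlt'
  exact ht (hηs (by simpa using hlt'))

/-- Every point near the complete end is joined to a fixed circle by the lift of a segment. -/
theorem exists_segment_from_circle (hG : DifferentiableOn ℂ G (PDisk ε))
    (hlt : ∀ z ∈ PDisk ε, ‖deriv F z‖ < ‖deriv G z‖) (hG' : ∀ z ∈ PDisk ε, deriv G z ≠ 0)
    (hc : CompleteAtZero ε F G) {r : ℝ} (hr : r < ε) {z : ℂ} (hz : z ∈ PDisk r) :
    ∃ γ : ℝ → PDisk ε, ContinuousOn γ (Icc 0 1) ∧ ‖(γ 0 : ℂ)‖ = r ∧ (γ 1 : ℂ) = z ∧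
      ∀ t ∈ Icc (0 : ℝ) 1, ‖(γ t : ℂ)‖ ≤ r ∧ G (γ t) = G (γ 0) + t * (G z - G (γ 0)) := by
  by_contra hno
  have hp : IsLocalHomeomorph (fun z : PDisk ε => G z) :=
    isLocalHomeomorph_domRestrict (isOpen_pdisk ε)
      (isLocalHomeomorphOn_of_deriv_ne_zero (isOpen_pdisk ε) hG hG')
  have hsub := pdisk_mono hr.le
  have hp' : IsLocalHomeomorph (fun z : PDisk r => G z) :=
    isLocalHomeomorph_domRestrict (isOpen_pdisk r)
      (isLocalHomeomorphOn_of_deriv_ne_zero (isOpen_pdisk r) (hG.mono hsub)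
        fun z hz => hG' z (hsub hz))
  -- If no such segment exists, a lift starting at `z` never reaches the circle of radius `r`, and
  -- completeness keeps it off the puncture. So all segments issuing from `G z` lift inside `PDisk
  -- r`.
  have hlift : ∀ y : ℂ, ∃ γ : ℝ → PDisk r, ContinuousOn γ (Icc 0 1) ∧ γ 0 = ⟨z, hz⟩ ∧
      ∀ t ∈ Icc (0 : ℝ) 1, G (γ t) = G z + t * (y - G z) := by
    intro y
    refine exists_lift hp' (σ := fun t : ℝ => G z + t * (y - G z)) (by fun_prop) (by simp) ?_
    intro T hT γ hγ hγ0 hγl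
    let β : ℝ → PDisk ε := fun t => inclusion hsub (γ t)
    have hβ : ContinuousOn β (Ico 0 T) := (continuous_inclusion hsub).comp_continuousOn hγ
    obtain ⟨e, he⟩ := exists_tendsto_segment_lift hG hlt hc hp hr hT.1 hβ hγl
      fun t _ => (γ t).2.2.le
    have he' : Tendsto (fun t => (γ t : ℂ)) (𝓝[<] T) (𝓝 e) :=
      (continuous_subtype_val.tendsto e).comp he
    have her : ‖(e : ℂ)‖ ≤ r := le_of_tendsto he'.norm (Eventually.of_forall fun t => (γ t).2.2.le)
    rcases her.lt_or_eq with h | h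
    · exact ⟨⟨e, e.2.1, h⟩, tendsto_subtype_rng.2 he'⟩
    -- The lift has reached the circle: run backwards, it is the segment that `hno` excludes.
    · exfalso
      have hGe : G e = G z + T * (y - G z) := by
        refine tendsto_nhds_unique ((hp.continuous.tendsto e).comp he) ?_
        have h1 : Tendsto (fun t : ℝ => G z + t * (y - G z)) (𝓝[<] T) (𝓝 (G z + T * (y - G z))) :=
          ((by fun_prop : Continuous fun t : ℝ => G z + t * (y - G z)).tendsto T).mono_left
            nhdsWithin_le_nhds
        refine h1.congr' ?_
        filter_upwards [Ioo_mem_nhdsLT hT.1] with t ht using (hγl t ⟨ht.1.le, ht.2⟩).symm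
      have hupd : ∀ t ∈ Icc 0 T, ‖(Function.update β T e t : ℂ)‖ ≤ r ∧
          G (Function.update β T e t) = G z + t * (y - G z) := by
        intro t ht
        rcases ht.2.lt_or_eq with h' | h'
        · rw [Function.update_of_ne h'.ne]
          exact ⟨(γ t).2.2.le, hγl t ⟨ht.1, h'⟩⟩
        · rw [h', Function.update_self]
          exact ⟨her, hGe⟩
      have hmap : MapsTo (fun t : ℝ => T * (1 - t)) (Icc 0 1) (Icc 0 T) := fun t ht =>
        ⟨mul_nonneg hT.1.le (by linarith [ht.2]), by nlinarith [hT.1, ht.1]⟩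
      have hβ0 : (β 0 : ℂ) = z := by simp [β, hγ0]
      refine hno ⟨fun t => Function.update β T e (T * (1 - t)),
        (continuousOn_update_of_tendsto hT.1 hβ he).comp (by fun_prop) hmap, ?_, ?_, ?_⟩
      · simpa using h
      · simp [Function.update_of_ne hT.1.ne, hβ0]
      · intro t ht
        have h0 := hupd _ (hmap ht)
        refine ⟨h0.1, h0.2.trans ?_⟩
        simp only [sub_zero, mul_one, Function.update_self, hGe]
        push_cast
        ring
  choose Γ hΓc hΓ0 hΓl using hlift
  have hcont : Continuous fun q : unitInterval × ℂ => Γ q.2 q.1 := by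
    refine hp'.continuous_lift (T2Space.isSeparatedMap _)
      ⟨fun q : unitInterval × ℂ => G z + ((q.1 : ℝ) : ℂ) * (q.2 - G z), by fun_prop⟩ ?_ ?_ ?_
    · ext q
      exact hΓl q.2 q.1 q.1.2
    · simpa [hΓ0] using continuous_const
    · intro y
      exact (hΓc y).comp_continuous continuous_subtype_val fun t => t.2
  -- The endpoints of the lifts form a right inverse of `G` that is entire and bounded, against
  -- Liouville's theorem.
  let g : ℂ → ℂ := fun y => Γ y 1
  have hgc : Continuous g := continuous_subtype_val.comp
    (hcont.comp (by fun_prop : Continuous fun y : ℂ => ((1 : unitInterval), y)))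
  have hGg : ∀ y, G (g y) = y := fun y => by
    have := hΓl y 1 ⟨zero_le_one, le_rfl⟩
    simpa using this
  have hgd : Differentiable ℂ g := fun y => by
    have hmem := hsub (Γ y 1).2
    exact ((hG.differentiableAt ((isOpen_pdisk ε).mem_nhds hmem)).hasDerivAt.of_local_left_inverse
      hgc.continuousAt (hG' _ hmem) (Eventually.of_forall hGg)).differentiableAt
  have hgb : Bornology.IsBounded (range g) := by
    refine (Metric.isBounded_ball (x := (0 : ℂ)) (r := r)).subset ?_
    rintro _ ⟨y, rfl⟩
    simpa using (Γ y 1).2.2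
  have h01 := hgd.apply_eq_apply_of_bounded hgb 0 1
  have := hGg 0
  rw [h01, hGg] at this
  exact one_ne_zero this

/-- A holomorphic function whose differential defines a complete flat metric at a puncture tends
to infinity there. -/
theorem tendsto_cobounded_of_complete (hε : 0 < ε) (hG : DifferentiableOn ℂ G (PDisk ε))
    (hlt : ∀ z ∈ PDisk ε, ‖deriv F z‖ < ‖deriv G z‖) (hc : CompleteAtZero ε F G) :
    Tendsto G (𝓝[≠] 0) (Bornology.cobounded ℂ) := by
  have hG' : ∀ z ∈ PDisk ε, deriv G z ≠ 0 := fun z hz h0 => by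
    have := hlt z hz
    rw [h0, norm_zero] at this
    exact absurd (norm_nonneg _) (not_le.2 this)
  have hp : IsLocalHomeomorph (fun z : PDisk ε => G z) :=
    isLocalHomeomorph_domRestrict (isOpen_pdisk ε)
      (isLocalHomeomorphOn_of_deriv_ne_zero (isOpen_pdisk ε) hG hG')
  rw [← tendsto_norm_atTop_iff_cobounded, tendsto_atTop]
  by_contra hno
  push Not at hno
  obtain ⟨R, hR⟩ := hno
  obtain ⟨r, hr0, hr⟩ := exists_between hε
  have hfr : ∃ᶠ z in 𝓝[≠] (0 : ℂ), z ∈ PDisk r ∧ ‖G z‖ ≤ R :=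
    (hR.and_eventually (pdisk_mem_nhdsNE hr0)).mono fun z hz => ⟨hz.2, hz.1.le⟩
  obtain ⟨z, hz0, hz⟩ := exists_seq_forall_of_frequently hfr
  choose γ hγc hγ0 hγ1 hγ using fun n => exists_segment_from_circle hG hlt hG' hc hr (hz n).1
  -- The origins lie on a circle and the targets in a closed ball, so the segments subconverge to
  -- the segment from `G c` to `w`.
  obtain ⟨⟨c, w⟩, hcw, φ, hφ, hlim⟩ := ((isCompact_sphere (0 : ℂ) r).prod
    (isCompact_closedBall (0 : ℂ) R)).tendsto_subseq
    (x := fun n => ((γ n 0 : ℂ), G (z n))) fun n =>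
      ⟨by simpa using hγ0 n, by simpa using (hz n).2⟩
  have hcr : ‖c‖ = r := by simpa using hcw.1
  have hlc : Tendsto (fun n => (γ (φ n) 0 : ℂ)) atTop (𝓝 c) := (continuous_fst.tendsto _).comp hlim
  have hlw : Tendsto (fun n => G (z (φ n))) atTop (𝓝 w) := (continuous_snd.tendsto _).comp hlim
  let c' : PDisk ε := ⟨c, by rw [hcr]; exact hr0, by rw [hcr]; exact hr⟩
  have hlc' : Tendsto (fun n => γ (φ n) 0) atTop (𝓝 c') := tendsto_subtype_rng.2 hlc
  have hGc : Tendsto (fun n => G (γ (φ n) 0)) atTop (𝓝 (G c)) := (hp.continuous.tendsto c').comp hlc'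
  let σ : ℕ → ℝ → ℂ := fun n t => G (γ (φ n) 0) + t * (G (z (φ n)) - G (γ (φ n) 0))
  have hσ : ∀ n, Continuous (σ n) := fun n => by fun_prop
  have hσl : ∀ t, Tendsto (fun q : ℕ × ℝ => σ q.1 q.2) (atTop ×ˢ 𝓝 t) (𝓝 (G c + t * (w - G c))) := by
    intro t
    have h1 := hGc.comp (tendsto_fst (f := atTop) (g := 𝓝 t))
    have h2 := hlw.comp (tendsto_fst (f := atTop) (g := 𝓝 t))
    have h3 := (Complex.continuous_ofReal.tendsto t).comp (tendsto_snd (f := (atTop : Filter ℕ)))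
    exact h1.add (h3.mul (h2.sub h1))
  have hstab : ∀ {s : Set ℝ} {β : ℝ → PDisk ε}, s.OrdConnected → s ⊆ Icc 0 1 → (0 : ℝ) ∈ s →
      ContinuousOn β s → β 0 = c' → (∀ t ∈ s, G (β t) = G c + t * (w - G c)) → ∀ t ∈ s,
      Tendsto (fun n => γ (φ n) t) atTop (𝓝 (β t)) := by
    intro s β hs hsI h0 hβ hβ0 hβl t ht
    exact tendsto_lift hp hs hσ hσl (fun n => (hγc (φ n)).mono hsI) hβ
      (fun n t ht => by simpa [σ] using (hγ (φ n) t (hsI ht)).2) hβl h0 ht (hβ0 ▸ hlc')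
  -- The limit segment lifts from `c`: being a limit of the `γ`, its lift stays in `‖·‖ ≤ r`, and
  -- completeness keeps it away from 0. Its endpoint is then the limit of the points `z (φ n)`,
  -- which tend to the missing point 0.
  obtain ⟨β, hβc, hβ0, hβl⟩ := exists_lift hp (σ := fun t : ℝ => G c + t * (w - G c)) (e₀ := c')
    (by fun_prop) (by simp [c']) (by
      intro T hT β hβ hβ0 hβl
      refine exists_tendsto_segment_lift hG hlt hc hp hr hT.1 hβ hβl fun t ht => ?_
      have h1 := hstab ordConnected_Ico (fun t ht => ⟨ht.1, ht.2.le.trans hT.2⟩) ⟨le_rfl, hT.1⟩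
        hβ hβ0 hβl t ht
      exact le_of_tendsto ((continuous_subtype_val.tendsto _).comp h1).norm
        (Eventually.of_forall fun n => (hγ (φ n) t ⟨ht.1, ht.2.le.trans hT.2⟩).1))
  have h1 := hstab ordConnected_Icc subset_rfl ⟨le_rfl, zero_le_one⟩ hβc hβ0 hβl 1
    ⟨zero_le_one, le_rfl⟩
  have h2 : Tendsto (fun n => z (φ n)) atTop (𝓝 (β 1 : ℂ)) :=
    ((continuous_subtype_val.tendsto _).comp h1).congr fun n => hγ1 (φ n)
  have h3 : Tendsto (fun n => z (φ n)) atTop (𝓝 0) :=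
    (hz0.mono_right nhdsWithin_le_nhds).comp hφ.tendsto_atTop
  have h4 := (β 1).2.1
  rw [tendsto_nhds_unique h2 h3, norm_zero] at h4
  exact lt_irrefl _ h4

end Pole

/-! ### Normal form of the Weierstrass data at the end -/

section NormalForm

/-- Riemann's removable singularity theorem, later applied to 1/G, dF/dG, F - bG and injective
changes of parameter. -/
theorem exists_analyticAt_of_tendsto_mul {f : ℂ → ℂ}
    (hd : ∀ᶠ z in 𝓝[≠] (0 : ℂ), DifferentiableAt ℂ f z)
    (hf : Tendsto (fun z => z * f z) (𝓝[≠] 0) (𝓝 0)) :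
    ∃ k : ℂ → ℂ, AnalyticAt ℂ k 0 ∧ ∀ᶠ z in 𝓝[≠] (0 : ℂ), f z = k z := by
  -- The value `f 0` is arbitrary; it does no harm because `z * f 0` tends to 0.
  have ho : (fun z => f z - f 0) =o[𝓝[≠] 0] fun z : ℂ => (z - 0)⁻¹ := by
    rw [Asymptotics.isLittleO_iff_tendsto' (by
      filter_upwards [self_mem_nhdsWithin] with z hz h0
      exact absurd (by simpa using h0) hz)]
    have h1 : Tendsto (fun z : ℂ => z * f z - z * f 0) (𝓝[≠] 0) (𝓝 (0 - 0 * f 0)) :=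
      hf.sub ((continuous_id.mul continuous_const).tendsto (0 : ℂ) |>.mono_left nhdsWithin_le_nhds)
    rw [zero_mul, sub_zero] at h1
    refine h1.congr fun z => ?_
    rw [sub_zero, div_inv_eq_mul]; ring
  have h := Complex.differentiableOn_update_limUnder_insert_of_isLittleO
    (s := {z | DifferentiableAt ℂ f z}) hd (fun z hz => hz.differentiableWithinAt) ho
  refine ⟨_, h.analyticAt (insert_mem_nhds_iff.2 hd), ?_⟩
  filter_upwards [self_mem_nhdsWithin] with z hz
  rw [Function.update_of_ne hz]

/-- 1/G extends holomorphically with the value 0 at 0 and is not identically zero; n is the order of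
this zero. -/
theorem exists_pole_order {G : ℂ → ℂ} (hd : ∀ᶠ z in 𝓝[≠] (0 : ℂ), DifferentiableAt ℂ G z)
    (hG : Tendsto G (𝓝[≠] 0) (Bornology.cobounded ℂ)) :
    ∃ (n : ℕ) (e : ℂ → ℂ), 0 < n ∧ AnalyticAt ℂ e 0 ∧ e 0 ≠ 0 ∧
      ∀ᶠ z in 𝓝[≠] (0 : ℂ), z ^ n * G z = e z := by
  have hinv : Tendsto (fun z => (G z)⁻¹) (𝓝[≠] 0) (𝓝 0) := tendsto_inv₀_cobounded.comp hG
  have hne : ∀ᶠ z in 𝓝[≠] (0 : ℂ), G z ≠ 0 := hG.eventually_ne_cobounded 0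
  obtain ⟨k, hk, hGk⟩ := exists_analyticAt_of_tendsto_mul (f := fun z => (G z)⁻¹)
    (by filter_upwards [hd, hne] with z h1 h2 using h1.inv h2)
    (by simpa using (tendsto_id.mono_left nhdsWithin_le_nhds).mul hinv)
  have hk0 : k 0 = 0 := tendsto_nhds_unique (hk.continuousAt.tendsto.mono_left nhdsWithin_le_nhds)
    (hinv.congr' hGk)
  obtain ⟨n, g, hg, hg0, hkg⟩ := hk.exists_eventuallyEq_pow_smul_nonzero_iff.2 fun h0 => by
    obtain ⟨z, hz, hz', hz''⟩ := ((h0.filter_mono nhdsWithin_le_nhds).and (hGk.and hne)).exists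
    rw [hz] at hz'
    exact hz'' (inv_eq_zero.1 hz')
  refine ⟨n, fun z => (g z)⁻¹, ?_, hg.inv hg0, inv_ne_zero hg0, ?_⟩
  · rcases Nat.eq_zero_or_pos n with rfl | h
    · have := hkg.self_of_nhds
      rw [hk0] at this
      exact absurd (by simpa using this.symm) hg0
    · exact h
  · filter_upwards [hGk, hkg.filter_mono nhdsWithin_le_nhds, self_mem_nhdsWithin] with z h1 h2 hz
    have hz : z ≠ 0 := hz
    rw [h2, sub_zero, smul_eq_mul] at h1
    rw [← inv_inv (G z), h1, mul_inv, ← mul_assoc, mul_inv_cancel₀ (pow_ne_zero _ hz), one_mul]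

/-- Integrating H' along the radius from z out to the circle of radius ρ gives |zⁿH(z)| ≤ |z|ⁿM +
Cρ. Take ρ small first, then z. -/
theorem tendsto_pow_mul_of_deriv_bound {H : ℂ → ℂ} {δ C : ℝ} (hδ : 0 < δ) {n : ℕ} (hn : 0 < n)
    (hH : DifferentiableOn ℂ H (PDisk δ)) (hC : ∀ z ∈ PDisk δ, ‖z ^ n * deriv H z‖ ≤ C) :
    Tendsto (fun z => z ^ n * H z) (𝓝[≠] 0) (𝓝 0) := by
  have hC0 : 0 ≤ C := (norm_nonneg _).trans (hC (δ / 2 : ℝ) (by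
    constructor <;> rw [Complex.norm_real, Real.norm_eq_abs, abs_of_pos (half_pos hδ)] <;> linarith))
  rw [tendsto_zero_iff_norm_tendsto_zero]
  refine (Metric.tendsto_nhds).2 fun η hη => ?_
  obtain ⟨ρ, hρ0, hρ⟩ := exists_between (lt_min hδ (div_pos hη (by positivity : 0 < 2 * (C + 1))))
  have hρδ : ρ < δ := hρ.trans_le (min_le_left _ _)
  have hρη : C * ρ < η / 2 := by
    have h1 : ρ * (2 * (C + 1)) < η :=
      (lt_div_iff₀ (by positivity)).1 (hρ.trans_le (min_le_right _ _))
    nlinarith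
  have hsph : Metric.sphere (0 : ℂ) ρ ⊆ PDisk δ := fun z hz => by
    have : ‖z‖ = ρ := by simpa using hz
    exact ⟨this ▸ hρ0, this ▸ hρδ⟩
  obtain ⟨M, hM⟩ := (isCompact_sphere (0 : ℂ) ρ).exists_bound_of_continuousOn
    (hH.continuousOn.mono hsph)
  have hlim : Tendsto (fun z : ℂ => ‖z‖ ^ n * M) (𝓝[≠] 0) (𝓝 0) := by
    have : Tendsto (fun z : ℂ => ‖z‖ ^ n * M) (𝓝 0) (𝓝 (‖(0 : ℂ)‖ ^ n * M)) :=
      (by fun_prop : Continuous fun z : ℂ => ‖z‖ ^ n * M).tendsto 0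
    rw [norm_zero, zero_pow hn.ne', zero_mul] at this
    exact this.mono_left nhdsWithin_le_nhds
  filter_upwards [hlim.eventually_lt_const (half_pos hη), pdisk_mem_nhdsNE hρ0] with z hz1 hz
  have hzpos : 0 < ‖z‖ := hz.1
  set z₁ : ℂ := ((ρ / ‖z‖ : ℝ) : ℂ) * z with hz₁
  have hz₁n : ‖z₁‖ = ρ := by
    rw [hz₁, norm_mul, Complex.norm_real, Real.norm_eq_abs, abs_of_pos (div_pos hρ0 hzpos),
      div_mul_cancel₀ _ hzpos.ne']
  have hq1 : 1 ≤ ρ / ‖z‖ := (one_le_div hzpos).2 hz.2.le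
  have hseg : ∀ w ∈ segment ℝ z z₁, ∃ t : ℝ, 1 ≤ t ∧ t ≤ ρ / ‖z‖ ∧ w = t * z := by
    intro w hw
    rw [segment_eq_image] at hw
    obtain ⟨θ, hθ, rfl⟩ := hw
    refine ⟨(1 - θ) + θ * (ρ / ‖z‖), ?_, ?_, ?_⟩
    · nlinarith [hθ.1]
    · nlinarith [hθ.2]
    · simp only [hz₁, Complex.real_smul]; push_cast; ring
  have hsegn : ∀ w ∈ segment ℝ z z₁, ‖z‖ ≤ ‖w‖ ∧ ‖w‖ ≤ ρ := by
    intro w hw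
    obtain ⟨t, ht1, ht2, rfl⟩ := hseg w hw
    rw [norm_mul, Complex.norm_real, Real.norm_eq_abs, abs_of_pos (by linarith)]
    exact ⟨by nlinarith, (le_div_iff₀ hzpos).1 ht2⟩
  have hsegP : ∀ w ∈ segment ℝ z z₁, w ∈ PDisk δ := fun w hw =>
    ⟨hzpos.trans_le (hsegn w hw).1, (hsegn w hw).2.trans_lt hρδ⟩
  have hmv := (convex_segment z z₁).norm_image_sub_le_of_norm_deriv_le (f := H)
    (C := C / ‖z‖ ^ n) (fun w hw => hH.differentiableAt ((isOpen_pdisk δ).mem_nhds (hsegP w hw)))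
    (fun w hw => by
      have h1 := hC w (hsegP w hw)
      rw [norm_mul, norm_pow] at h1
      rw [le_div_iff₀ (pow_pos hzpos n)]
      refine le_trans ?_ h1
      rw [mul_comm]
      exact mul_le_mul_of_nonneg_right (pow_le_pow_left₀ hzpos.le (hsegn w hw).1 n) (norm_nonneg _))
    (right_mem_segment ℝ z z₁) (left_mem_segment ℝ z z₁)
  have hzz : ‖z - z₁‖ ≤ ρ := by
    have : z - z₁ = ((1 - ρ / ‖z‖ : ℝ) : ℂ) * z := by rw [hz₁]; push_cast; ring
    rw [this, norm_mul, Complex.norm_real, Real.norm_eq_abs, abs_of_nonpos (by linarith)]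
    have : ρ / ‖z‖ * ‖z‖ = ρ := div_mul_cancel₀ _ hzpos.ne'
    nlinarith
  have hHz : ‖H z‖ ≤ M + C / ‖z‖ ^ n * ρ := by
    have h1 : ‖H z‖ ≤ ‖H z₁‖ + ‖H z - H z₁‖ := by
      have := norm_add_le (H z₁) (H z - H z₁)
      rwa [add_sub_cancel] at this
    have h2 := hM z₁ (by simpa using hz₁n)
    have h3 : C / ‖z‖ ^ n * ‖z - z₁‖ ≤ C / ‖z‖ ^ n * ρ := by gcongr
    linarith
  have hfin : ‖z ^ n * H z‖ ≤ ‖z‖ ^ n * M + C * ρ := by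
    rw [norm_mul, norm_pow]
    calc ‖z‖ ^ n * ‖H z‖ ≤ ‖z‖ ^ n * (M + C / ‖z‖ ^ n * ρ) := by gcongr
      _ = _ := by field_simp
  rw [Real.dist_eq, sub_zero, abs_of_nonneg (norm_nonneg _)]
  linarith

variable {ε : ℝ} {F G : ℂ → ℂ}

/-- The normal form of the Weierstrass data at a complete end. -/
theorem exists_normal_form (hε : 0 < ε) (hF : DifferentiableOn ℂ F (PDisk ε))
    (hG : DifferentiableOn ℂ G (PDisk ε))
    (hlt : ∀ z ∈ PDisk ε, ‖deriv F z‖ < ‖deriv G z‖) (hc : CompleteAtZero ε F G) :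
    ∃ (n : ℕ) (b : ℂ) (e : ℂ → ℂ), 0 < n ∧ ‖b‖ < 1 ∧ AnalyticAt ℂ e 0 ∧ e 0 ≠ 0 ∧
      (∀ᶠ z in 𝓝[≠] (0 : ℂ), z ^ n * G z = e z) ∧
      Tendsto (fun z => z ^ n * (F z - b * G z)) (𝓝[≠] 0) (𝓝 0) := by
  have hG' : ∀ z ∈ PDisk ε, deriv G z ≠ 0 := fun z hz h0 => by
    have := hlt z hz
    rw [h0, norm_zero] at this
    exact absurd (norm_nonneg _) (not_le.2 this)
  have hd : ∀ᶠ z in 𝓝[≠] (0 : ℂ), z ∈ PDisk ε := pdisk_mem_nhdsNE hε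
  have hFa : ∀ z ∈ PDisk ε, AnalyticAt ℂ F z := fun z hz =>
    hF.analyticAt ((isOpen_pdisk ε).mem_nhds hz)
  have hGa : ∀ z ∈ PDisk ε, AnalyticAt ℂ G z := fun z hz =>
    hG.analyticAt ((isOpen_pdisk ε).mem_nhds hz)
  obtain ⟨n, e, hn, he, he0, hGe⟩ := exists_pole_order
    (by filter_upwards [hd] with z hz using (hGa z hz).differentiableAt)
    (tendsto_cobounded_of_complete hε hG hlt hc)
  -- the quotient of the differentials
  have hq1 : ∀ z ∈ PDisk ε, ‖deriv F z / deriv G z‖ < 1 := fun z hz => by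
    rw [norm_div, div_lt_one (norm_pos_iff.2 (hG' z hz))]; exact hlt z hz
  obtain ⟨k, hk, hqk⟩ := exists_analyticAt_of_tendsto_mul (f := fun z => deriv F z / deriv G z)
    (by filter_upwards [hd] with z hz using
          (hFa z hz).deriv.differentiableAt.div (hGa z hz).deriv.differentiableAt (hG' z hz))
    (by
      refine squeeze_zero_norm' (a := fun z : ℂ => ‖z‖) ?_ ?_
      · filter_upwards [hd] with z hz
        rw [norm_mul]
        exact mul_le_of_le_one_right (norm_nonneg _) (hq1 z hz).le
      · have := (continuous_norm (E := ℂ)).tendsto 0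
        rw [norm_zero] at this
        exact this.mono_left nhdsWithin_le_nhds)
  have hk1 : ∀ᶠ z in 𝓝[≠] (0 : ℂ), ‖k z‖ < 1 := by
    filter_upwards [hqk, hd] with z h1 h2
    rw [← h1]; exact hq1 z h2
  have hb1 : ‖k 0‖ ≤ 1 := le_of_tendsto
    (hk.continuousAt.norm.tendsto.mono_left nhdsWithin_le_nhds) (hk1.mono fun z hz => hz.le)
  -- If the modulus were 1, it would be a local maximum, so `k` would be constant near 0, against
  -- `‖k z‖ < 1` off 0.
  have hb : ‖k 0‖ < 1 := by
    refine hb1.lt_of_ne fun h => ?_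
    have hmax : IsLocalMax (norm ∘ k) 0 := by
      have := eventually_nhdsWithin_iff.1 hk1
      filter_upwards [this] with z hz
      by_cases h0 : z = 0
      · rw [h0]
      · simp only [Function.comp, h]; exact (hz h0).le
    have hconst := Complex.eventually_eq_of_isLocalMax_norm
      (hk.eventually_analyticAt.mono fun z hz => hz.differentiableAt) hmax
    obtain ⟨z, hz1, hz2⟩ := (hk1.and (hconst.filter_mono nhdsWithin_le_nhds)).exists
    rw [hz2, h] at hz1
    exact lt_irrefl _ hz1
  refine ⟨n, k 0, e, hn, hb, he, he0, hGe, ?_⟩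
  -- the derivative of the remainder
  have hlip : (fun z => k z - k 0) =O[𝓝 0] fun z : ℂ => z - 0 :=
    hk.differentiableAt.hasDerivAt.isBigO_sub
  obtain ⟨C₁, hC₁⟩ := hlip.bound
  have hbd : ∀ᶠ z in 𝓝 (0 : ℂ), ‖z * deriv e z - n * e z‖ ≤ ‖0 * deriv e 0 - n * e 0‖ + 1 := by
    have : ContinuousAt (fun z => ‖z * deriv e z - n * e z‖) 0 :=
      ((continuousAt_id.mul he.deriv.continuousAt).sub
        (continuousAt_const.mul he.continuousAt)).norm
    exact (this.eventually_lt continuousAt_const (lt_add_one _)).mono fun z hz => hz.le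
  -- This is z times the derivative of zⁿG = e; it bounds dG/dz by a multiple of |z|⁻ⁿ⁻¹. The factor
  -- k - k(0) = O(z) in d(F - k(0)G) gains one power.
  have hderiv : ∀ᶠ z in 𝓝[≠] (0 : ℂ), z ^ (n + 1) * deriv G z = z * deriv e z - n * e z := by
    filter_upwards [eventually_eventually_nhdsWithin.2 hGe, hd, self_mem_nhdsWithin] with z h1 h2 hz
    have h3 : ∀ᶠ w in 𝓝 z, w ^ n * G w = e w := by
      rwa [(isOpen_compl_singleton (x := (0 : ℂ))).nhdsWithin_eq hz] at h1
    have h4 : HasDerivAt (fun w => w ^ n * G w) (n * z ^ (n - 1) * G z + z ^ n * deriv G z) z :=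
      (hasDerivAt_pow n z).mul (hGa z h2).differentiableAt.hasDerivAt
    have h5 : deriv e z = n * z ^ (n - 1) * G z + z ^ n * deriv G z := by
      rw [← h4.deriv]; exact (Filter.EventuallyEq.deriv_eq h3).symm
    rw [h5, ← h3.self_of_nhds]
    obtain ⟨m, rfl⟩ : ∃ m, n = m + 1 := ⟨n - 1, by omega⟩
    simp only [Nat.add_sub_cancel]
    ring
  obtain ⟨δ, hδ, hδε, hall⟩ := exists_pdisk_of_eventually
    (hderiv.and (hqk.and ((hC₁.and hbd).filter_mono nhdsWithin_le_nhds))) hε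
  refine tendsto_pow_mul_of_deriv_bound hδ hn
    (C := C₁ * (‖0 * deriv e 0 - n * e 0‖ + 1))
    ((hF.sub (hG.const_mul _)).mono (pdisk_mono hδε)) fun z hz => ?_
  obtain ⟨h1, h2, h3, h4⟩ := hall z hz
  have hzε := pdisk_mono hδε hz
  have hz0 : z ≠ 0 := norm_pos_iff.1 hz.1
  have hdH : deriv (fun z => F z - k 0 * G z) z = (k z - k 0) * deriv G z := by
    have := ((hFa z hzε).differentiableAt.hasDerivAt.sub
      ((hGa z hzε).differentiableAt.hasDerivAt.const_mul (k 0))).deriv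
    rw [← h2, sub_mul, div_mul_cancel₀ _ (hG' z hzε)]
    exact this
  rw [hdH]
  have h5 : z ^ n * ((k z - k 0) * deriv G z) = (k z - k 0) / z * (z * deriv e z - n * e z) := by
    rw [← h1]; field_simp; ring
  rw [h5, norm_mul]
  refine mul_le_mul ?_ h4 (norm_nonneg _) ?_
  · rw [norm_div, div_le_iff₀ hz.1]; simpa using h3
  · have : 0 ≤ C₁ * ‖z‖ := (norm_nonneg _).trans (by simpa using h3)
    exact nonneg_of_mul_nonneg_left this hz.1

end NormalForm

/-! ### Real primitives of Re (F dG) -/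

section RealPart

/-- The real linear form `v ↦ Re (c v)`. -/
noncomputable def reMul (c : ℂ) : ℂ →L[ℝ] ℝ := Complex.reCLM ∘L ContinuousLinearMap.mul ℝ ℂ c

@[simp] theorem reMul_apply (c v : ℂ) : reMul c v = (c * v).re := rfl

theorem HasDerivAt.hasFDerivAt_re {P : ℂ → ℂ} {c z : ℂ} (h : HasDerivAt P c z) :
    HasFDerivAt (fun w => (P w).re) (reMul c) z := by
  have h1 : HasFDerivAt (fun w => (P w).re) (Complex.reCLM ∘L
      (ContinuousLinearMap.toSpanSingleton ℂ c).restrictScalars ℝ) z :=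
    Complex.reCLM.hasFDerivAt.comp z (h.hasFDerivAt.restrictScalars ℝ)
  convert h1 using 1
  ext v; simp [mul_comm]

variable {Ω : Set ℂ} {F G : ℂ → ℂ} {h : ℂ → ℝ}

theorem formFdG_apply (F G : ℂ → ℂ) (z v : ℂ) : formFdG F G z v = F z * deriv G z * v := by
  simp [formFdG, fderiv_eq_smul_deriv]; ring

theorem continuousOn_formFdG (hΩ : IsOpen Ω) (hF : DifferentiableOn ℂ F Ω)
    (hG : DifferentiableOn ℂ G Ω) : ContinuousOn (formFdG F G) Ω :=
  hF.continuousOn.smul ((hG.contDiffOn hΩ (n := 1)).continuousOn_fderiv_of_isOpen hΩ le_rfl)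

/-- A real primitive of `Re (F dG)` is a determination of `Re ∫ F dG`. -/
theorem isReIntegral_of_hasFDerivAt (hΩ : IsOpen Ω) (hF : DifferentiableOn ℂ F Ω)
    (hG : DifferentiableOn ℂ G Ω)
    (hh : ∀ z ∈ Ω, HasFDerivAt h (reMul (F z * deriv G z)) z) : IsReIntegral Ω F G h := by
  intro z w γ hγ
  have hγm : ∀ t, γ.extend t ∈ Ω := fun t => by
    obtain ⟨u, hu⟩ : γ.extend t ∈ range γ := γ.extend_range ▸ mem_range_self t
    exact hu ▸ hγ.2 u
  have hint : CurveIntegrable (formFdG F G) γ :=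
    (continuousOn_formFdG hΩ hF hG).curveIntegrable_of_contDiffOn hγ.1 hγ.2
  have hre : (curveIntegral (formFdG F G) γ).re =
      ∫ t in (0 : ℝ)..1, (curveIntegralFun (formFdG F G) γ t).re := by
    rw [curveIntegral_def]
    exact (Complex.reCLM.intervalIntegral_comp_comm hint).symm
  rw [hre, intervalIntegral.integral_eq_sub_of_hasDerivAt_of_le (f := fun t => h (γ.extend t))
    zero_le_one ?_ ?_ ?_]
  · simp
  · have hc : ContinuousOn h Ω := fun x hx => (hh x hx).continuousAt.continuousWithinAt
    exact hc.comp γ.continuous_extend.continuousOn fun t _ => hγm t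
  · intro t ht
    have hd : HasDerivAt γ.extend (derivWithin γ.extend (Icc 0 1) t) t :=
      ((hγ.1.differentiableOn (by simp) t ⟨ht.1.le, ht.2.le⟩).hasDerivWithinAt).hasDerivAt
        (Icc_mem_nhds ht.1 ht.2)
    have := (hh _ (hγm t)).comp_hasDerivAt t hd
    rw [curveIntegralFun_def, formFdG_apply]
    exact this
  · exact ⟨Complex.reCLM.integrable_comp hint.1, Complex.reCLM.integrable_comp hint.2⟩

theorem isC1PathIn_segment {z w : ℂ} (hzw : segment ℝ z w ⊆ Ω) :
    IsC1PathIn Ω (Path.segment z w) := by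
  refine ⟨?_, fun t => hzw ?_⟩
  · have : ContDiff ℝ 1 (AffineMap.lineMap z w : ℝ → ℂ) := by
      rw [show (AffineMap.lineMap z w : ℝ → ℂ) = fun t => (1 - t) • z + t • w from
        funext fun t => AffineMap.lineMap_apply_module ..]
      fun_prop
    exact this.contDiffOn.congr (Path.eqOn_extend_segment z w)
  · rw [segment_eq_image_lineMap]
    exact ⟨t, t.2, by simp⟩

/-- Locally a determination of `Re ∫ F dG` is the real part of a holomorphic primitive. -/
theorem IsReIntegral.exists_primitive (hΩ : IsOpen Ω) (hF : DifferentiableOn ℂ F Ω)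
    (hG : DifferentiableOn ℂ G Ω) (hh : IsReIntegral Ω F G h) {z : ℂ} (hz : z ∈ Ω) :
    ∃ P : ℂ → ℂ, AnalyticAt ℂ P z ∧ HasDerivAt P (F z * deriv G z) z ∧
      ∀ᶠ w in 𝓝 z, h w = (P w).re := by
  obtain ⟨r, hr, hball⟩ := Metric.isOpen_iff.1 hΩ z hz
  have hd : DifferentiableOn ℂ (fun w => F w * deriv G w) (Metric.ball z r) :=
    (hF.mul (hG.deriv hΩ)).mono hball
  obtain ⟨P, hPz, hP⟩ := hd.isExactOn_ball.with_val_at z (h z : ℂ)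
  have hzb : z ∈ Metric.ball z r := Metric.mem_ball_self hr
  have hPa : AnalyticAt ℂ P z := by
    have : DifferentiableOn ℂ P (Metric.ball z r) := fun w hw =>
      (hP w hw).differentiableAt.differentiableWithinAt
    exact this.analyticAt (Metric.ball_mem_nhds z hr)
  refine ⟨P, hPa, hP z hzb, ?_⟩
  -- Both `h` and Re P change along a segment by Re ∫ F dG, and they agree at `z`.
  have hloc := isReIntegral_of_hasFDerivAt (h := fun w => (P w).re) Metric.isOpen_ball
    (hF.mono hball) (hG.mono hball) fun w hw => HasDerivAt.hasFDerivAt_re (hP w hw)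
  filter_upwards [Metric.ball_mem_nhds z hr] with w hw
  have hseg : segment ℝ z w ⊆ Metric.ball z r := (convex_ball z r).segment_subset hzb hw
  have h1 := hh z w _ (isC1PathIn_segment (hseg.trans hball))
  have h2 : (P w).re - (P z).re = _ := hloc z w _ (isC1PathIn_segment hseg)
  rw [hPz, Complex.ofReal_re] at h2
  linarith

theorem IsReIntegral.hasFDerivAt (hΩ : IsOpen Ω) (hF : DifferentiableOn ℂ F Ω)
    (hG : DifferentiableOn ℂ G Ω) (hh : IsReIntegral Ω F G h) {z : ℂ} (hz : z ∈ Ω) :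
    HasFDerivAt h (reMul (F z * deriv G z)) z := by
  obtain ⟨P, -, hP, hPh⟩ := hh.exists_primitive hΩ hF hG hz
  exact (HasDerivAt.hasFDerivAt_re hP).congr_of_eventuallyEq hPh

theorem IsReIntegral.contDiffOn (hΩ : IsOpen Ω) (hF : DifferentiableOn ℂ F Ω)
    (hG : DifferentiableOn ℂ G Ω) (hh : IsReIntegral Ω F G h) : ContDiffOn ℝ ∞ h Ω := by
  intro z hz
  obtain ⟨P, hPa, -, hPh⟩ := hh.exists_primitive hΩ hF hG hz
  have h1 : ContDiffAt ℝ ∞ P z := (hPa.contDiffAt (n := ∞)).restrict_scalars ℝ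
  exact ((Complex.reCLM.contDiff.contDiffAt.comp z h1).congr_of_eventuallyEq
    hPh).contDiffWithinAt

theorem IsReIntegral.periodCondition (hh : IsReIntegral Ω F G h) : PeriodCondition Ω F G :=
  fun z γ hγ => by rw [← hh z z γ hγ, sub_self]

/-- The front with Weierstrass data `(F, G)` attached to a determination `h` of `Re ∫ F dG`. -/
noncomputable def frontOf (F G : ℂ → ℂ) (h : ℂ → ℝ) (z : ℂ) : Space :=
  WithLp.toLp 2 (G z + conj (F z), (‖G z‖ ^ 2 - ‖F z‖ ^ 2) / 2 + (G z * F z).re - 2 * h z)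

theorem isImproperAffineFront_frontOf (hΩ : IsOpen Ω) (hF : DifferentiableOn ℂ F Ω)
    (hG : DifferentiableOn ℂ G Ω) (hreg : ∀ z ∈ Ω, ¬ (deriv F z = 0 ∧ deriv G z = 0))
    (hh : ∀ z ∈ Ω, HasFDerivAt h (reMul (F z * deriv G z)) z) :
    IsImproperAffineFront Ω F G (frontOf F G h) where
  holo_F := hF
  holo_G := hG
  regular := hreg
  period := (isReIntegral_of_hasFDerivAt hΩ hF hG hh).periodCondition
  repr := ⟨h, isReIntegral_of_hasFDerivAt hΩ hF hG hh, fun _ _ => rfl⟩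

end RealPart

/-! ### Interchanging the Weierstrass data -/

section HalfTurn

/-- The half-turn `(x₁, x₂, x₃) ↦ (x₁, -x₂, -x₃)`. -/
noncomputable def halfTurn : Space →L[ℝ] Space :=
  (WithLp.prodContinuousLinearEquiv 2 ℝ ℂ ℝ).symm.toContinuousLinearMap ∘L
    (Complex.conjCLE.toContinuousLinearMap.prodMap (-ContinuousLinearMap.id ℝ ℝ)) ∘L
      (WithLp.prodContinuousLinearEquiv 2 ℝ ℂ ℝ).toContinuousLinearMap

theorem halfTurn_apply (x : Space) : halfTurn x = WithLp.toLp 2 (conj x.fst, -x.snd) := rfl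

@[simp] theorem halfTurn_halfTurn (x : Space) : halfTurn (halfTurn x) = x := by
  simp [halfTurn_apply]; rfl

theorem norm_halfTurn (x : Space) : ‖halfTurn x‖ = ‖x‖ := by
  simp [halfTurn_apply, WithLp.prod_norm_eq_of_L2]

theorem isEmbedding_halfTurn : IsEmbedding halfTurn :=
  Function.LeftInverse.isEmbedding halfTurn_halfTurn halfTurn.continuous halfTurn.continuous

theorem IsEmbeddedEnd.halfTurn {ε : ℝ} {ψ : ℂ → Space} (h : IsEmbeddedEnd ε ψ) :
    IsEmbeddedEnd ε (fun z => halfTurn (ψ z)) := by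
  obtain ⟨δ, hδ, hδε, h1, h2, h3⟩ := h
  refine ⟨δ, hδ, hδε, ImproperAffine.halfTurn.contDiff.comp_contDiffOn h1, fun z hz => ?_,
    isEmbedding_halfTurn.comp h3⟩
  have hd : DifferentiableAt ℝ ψ z :=
    (h1.contDiffAt ((isOpen_pdisk δ).mem_nhds hz)).differentiableAt (by simp)
  rw [show (fun z => ImproperAffine.halfTurn (ψ z)) = ImproperAffine.halfTurn ∘ ψ from rfl,
    fderiv_comp z ImproperAffine.halfTurn.differentiableAt hd, ContinuousLinearMap.fderiv]
  exact isEmbedding_halfTurn.injective.comp (h2 z hz)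

variable {Ω : Set ℂ} {F G : ℂ → ℂ} {ψ : ℂ → Space} {ε δ : ℝ}

/-- Integration by parts: Re ∫ G dF = Re (FG) - Re ∫ F dG, which turns the third coordinate into its
opposite. -/
theorem IsImproperAffineFront.halfTurn (hΩ : IsOpen Ω) (h : IsImproperAffineFront Ω F G ψ) :
    IsImproperAffineFront Ω G F (fun z => halfTurn (ψ z)) := by
  obtain ⟨k, hk, hψ⟩ := h.repr
  have hint : IsReIntegral Ω G F (fun z => (F z * G z).re - k z) := by
    refine isReIntegral_of_hasFDerivAt hΩ h.holo_G h.holo_F fun z hz => ?_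
    have hFd := (h.holo_F.differentiableAt (hΩ.mem_nhds hz)).hasDerivAt
    have hGd := (h.holo_G.differentiableAt (hΩ.mem_nhds hz)).hasDerivAt
    have h1 := (HasDerivAt.hasFDerivAt_re (hFd.mul hGd)).sub (hk.hasFDerivAt hΩ h.holo_F h.holo_G hz)
    refine h1.congr_fderiv ?_
    ext v
    simp only [_root_.sub_apply, reMul_apply, ← Complex.sub_re]
    ring_nf
  refine ⟨h.holo_G, h.holo_F, fun z hz hz' => h.regular z hz hz'.symm, hint.periodCondition,
    _, hint, fun z hz => ?_⟩
  rw [hψ z hz, halfTurn_apply]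
  congr 1
  refine Prod.ext ?_ ?_
  · simp [add_comm]
  · simp [mul_comm (F z)]; ring

theorem IsImproperAffineSphere.halfTurn (hΩ : IsOpen Ω) (h : IsImproperAffineSphere Ω F G ψ) :
    IsImproperAffineSphere Ω G F (fun z => halfTurn (ψ z)) :=
  ⟨h.toIsImproperAffineFront.halfTurn hΩ, fun z hz => (h.nondegenerate z hz).symm⟩

theorem flatForm_comm (F G : ℂ → ℂ) : flatForm F G = flatForm G F := by
  ext z v
  simp only [flatForm]
  rw [mul_comm (deriv F z * v)]; ring

theorem CompleteAtZero.symm (h : CompleteAtZero ε F G) : CompleteAtZero ε G F := by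
  intro γ h1 h2 h3
  have := h γ h1 h2 h3
  rwa [flatLength, flatForm_comm] at this

theorem IsAsymptoticToPiece.halfTurn (h : IsAsymptoticToPiece ε ψ F G) :
    IsAsymptoticToPiece ε (fun z => halfTurn (ψ z)) G F := by
  obtain ⟨δ, ψ', hδ, hδε, ⟨Ψ, φ, v, hΨ, hφ, hφi, hφm, hψ', hc⟩, hlim⟩ := h
  refine ⟨δ, fun z => ImproperAffine.halfTurn (ψ' z), hδ, hδε,
    ⟨_, φ, ImproperAffine.halfTurn v, hΨ.halfTurn isOpen_compl_singleton, hφ, hφi, hφm,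
      fun z hz => by simp only [hψ' z hz, map_add], hc.symm⟩, ?_⟩
  refine hlim.congr fun z => ?_
  rw [← map_sub, norm_halfTurn]

theorem IsAsymptoticToModel.halfTurn (h : IsAsymptoticToModel ε ψ F G) :
    IsAsymptoticToModel ε (fun z => halfTurn (ψ z)) F G :=
  h.symm.imp IsAsymptoticToPiece.halfTurn IsAsymptoticToPiece.halfTurn

end HalfTurn

/-! ### A criterion for completeness -/

section Completeness

/-- The flat form is the pull-back of the Euclidean metric of the plane by G + conj F. -/
theorem sqrt_flatForm (F G : ℂ → ℂ) (z v : ℂ) :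
    Real.sqrt (flatForm F G z v) = ‖deriv G z * v + conj (deriv F z * v)‖ := by
  rw [← Real.sqrt_sq (norm_nonneg (deriv G z * v + conj (deriv F z * v)))]
  congr 1
  simp only [flatForm, ← Complex.normSq_eq_norm_sq, Complex.normSq_apply, Complex.add_re,
    Complex.add_im, Complex.conj_re, Complex.conj_im, Complex.mul_re]
  ring

/-- An end at which the planar part of the front is divergent is complete. -/
theorem completeAtZero_of_tendsto {δ : ℝ} {F G : ℂ → ℂ} (hF : DifferentiableOn ℂ F (PDisk δ))
    (hG : DifferentiableOn ℂ G (PDisk δ))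
    (h : Tendsto (fun z => G z + conj (F z)) (𝓝[≠] 0) (Bornology.cobounded ℂ)) :
    CompleteAtZero δ F G := by
  intro γ hγ hm hcl
  by_contra htop
  let β : ℝ → ℂ := fun t => G (γ t) + conj (F (γ t))
  have hsm : ∀ {K : ℂ → ℂ}, DifferentiableOn ℂ K (PDisk δ) →
      ContDiffOn ℝ 1 (fun t => K (γ t)) (Ico 0 1) := fun hK =>
    ((hK.contDiffOn (isOpen_pdisk δ) (n := 1)).restrict_scalars ℝ).comp hγ hm
  have hβ : ContDiffOn ℝ 1 β (Ico 0 1) :=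
    (hsm hG).add (Complex.conjCLE.contDiff.comp_contDiffOn (hsm hF))
  -- The flat length of `γ` is the Euclidean length of its planar image `β`. If finite, it bounds
  -- `β`, although `γ` accumulates where the planar part diverges.
  have hbound : ∀ t ∈ Ico (0 : ℝ) 1, ‖β t‖ ≤ ‖β 0‖ + (flatLength F G γ).toReal := by
    intro t ht
    have hsub : Icc 0 t ⊆ Ico (0 : ℝ) 1 := fun s hs => ⟨hs.1, hs.2.trans_lt ht.2⟩
    have h1 := enorm_sub_le_lintegral_deriv_of_contDiffOn_Icc (hβ.mono hsub) ht.1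
    have h2 : ∫⁻ s in Icc 0 t, ‖deriv β s‖ₑ ≤ flatLength F G γ := by
      rw [← restrict_Ioo_eq_restrict_Icc, flatLength]
      refine (setLIntegral_mono' measurableSet_Ioo fun s hs => ?_).trans
        (lintegral_mono_set (Ioo_subset_Ioo_right ht.2.le))
      have hs' : s ∈ Ico (0 : ℝ) 1 := ⟨hs.1.le, hs.2.trans ht.2⟩
      have hd : HasDerivAt γ (deriv γ s) s :=
        ((hγ.contDiffAt (Ico_mem_nhds hs.1 hs'.2)).differentiableAt (by simp)).hasDerivAt
      have hK : ∀ {K : ℂ → ℂ}, DifferentiableOn ℂ K (PDisk δ) →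
          HasDerivAt (fun t => K (γ t)) (deriv K (γ s) * deriv γ s) s := fun hK =>
        (hK.differentiableAt ((isOpen_pdisk δ).mem_nhds (hm hs'))).hasDerivAt.comp s hd
      have hβd : HasDerivAt β (deriv G (γ s) * deriv γ s + conj (deriv F (γ s) * deriv γ s)) s :=
        (hK hG).add (Complex.conjCLE.toContinuousLinearMap.hasFDerivAt.comp_hasDerivAt s (hK hF))
      rw [hβd.deriv, sqrt_flatForm, ofReal_norm]
    have h3 := ENNReal.toReal_mono htop (h1.trans h2)
    rw [toReal_enorm] at h3
    have h4 := norm_add_le (β 0) (β t - β 0)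
    rw [add_sub_cancel] at h4
    linarith
  rw [← tendsto_norm_atTop_iff_cobounded] at h
  have h5 := eventually_nhdsWithin_iff.1
    (h.eventually_gt_atTop (‖β 0‖ + (flatLength F G γ).toReal))
  obtain ⟨t, ht, htI⟩ := ((mapClusterPt_iff_frequently.1 hcl _ h5).and_eventually
    (Ioo_mem_nhdsLT (zero_lt_one (α := ℝ)))).exists
  have htI' : t ∈ Ico (0 : ℝ) 1 := ⟨htI.1.le, htI.2⟩
  exact absurd (hbound t htI') (not_le.2 (ht (norm_pos_iff.1 (hm htI').1)))

end Completeness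

/-! ### The planar part as a local homeomorphism -/

section PlanarPart

variable {Ω : Set ℂ} {F G : ℂ → ℂ}

/-- The real linear map `v ↦ g v + conj (f v)`. -/
noncomputable def planarDeriv (f g : ℂ) : ℂ →L[ℝ] ℂ :=
  ContinuousLinearMap.mul ℝ ℂ g +
    Complex.conjCLE.toContinuousLinearMap ∘L ContinuousLinearMap.mul ℝ ℂ f

@[simp] theorem planarDeriv_apply (f g v : ℂ) : planarDeriv f g v = g * v + conj (f * v) := rfl

theorem planarDeriv_injective {f g : ℂ} (h : ‖f‖ ≠ ‖g‖) :
    Function.Injective (planarDeriv f g) := by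
  rw [injective_iff_map_eq_zero]
  intro v hv
  rw [planarDeriv_apply, add_eq_zero_iff_eq_neg] at hv
  by_contra hv0
  have := congrArg norm hv
  rw [norm_neg, RCLike.norm_conj, norm_mul, norm_mul] at this
  exact h (mul_right_cancel₀ (norm_ne_zero_iff.2 hv0) this).symm

theorem hasStrictFDerivAt_planar {z : ℂ} (hF : AnalyticAt ℂ F z) (hG : AnalyticAt ℂ G z) :
    HasStrictFDerivAt (fun w => G w + conj (F w)) (planarDeriv (deriv F z) (deriv G z)) z := by
  have h1 := hG.hasStrictDerivAt.hasStrictFDerivAt.restrictScalars ℝ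
  have h2 := hF.hasStrictDerivAt.hasStrictFDerivAt.restrictScalars ℝ
  refine (h1.add (Complex.conjCLE.toContinuousLinearMap.hasStrictFDerivAt.comp z h2)).congr_fderiv ?_
  ext v
  simp [planarDeriv, mul_comm]

theorem isLocalHomeomorphOn_planar (hΩ : IsOpen Ω) (hF : DifferentiableOn ℂ F Ω)
    (hG : DifferentiableOn ℂ G Ω) (h : ∀ z ∈ Ω, ‖deriv F z‖ ≠ ‖deriv G z‖) :
    IsLocalHomeomorphOn (fun w => G w + conj (F w)) Ω := by
  intro z hz
  have hinj := planarDeriv_injective (h z hz)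
  let e : ℂ ≃L[ℝ] ℂ := ContinuousLinearEquiv.ofBijective (planarDeriv (deriv F z) (deriv G z))
    (LinearMap.ker_eq_bot.2 hinj)
    (LinearMap.range_eq_top.2 (LinearMap.injective_iff_surjective.1 hinj))
  have hd : HasStrictFDerivAt (fun w => G w + conj (F w)) (e : ℂ →L[ℝ] ℂ) z :=
    hasStrictFDerivAt_planar (hF.analyticAt (hΩ.mem_nhds hz)) (hG.analyticAt (hΩ.mem_nhds hz))
  exact ⟨hd.toOpenPartialHomeomorph _, hd.mem_toOpenPartialHomeomorph_source, rfl⟩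

end PlanarPart

/-! ### A winding argument -/

section Winding

/-- Two continuous n-th roots of the same function have a constant ratio on an interval. -/
theorem isDiscrete_setOf_pow_eq {n : ℕ} (hn : 0 < n) (K : ℂ) : IsDiscrete {w : ℂ | w ^ n = K} := by
  classical
  have : {w : ℂ | w ^ n = K} = ↑(Polynomial.nthRoots n K).toFinset := by
    ext w; simp [Polynomial.mem_nthRoots hn]
  rw [this]
  exact (Finset.finite_toSet _).isDiscrete

/-- If the `n`-th power of a loop turns exactly once, up to an error of less than a quarter turn,
then `n = 1`. -/
theorem eq_one_of_loop {n : ℕ} (hn : 0 < n) {c : ℝ → ℂ} {t₀ : ℝ}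
    (hc : ContinuousOn c (Icc t₀ (t₀ + 1))) (hloop : c (t₀ + 1) = c t₀) {K : ℂ}
    (hre : ∀ t ∈ Icc t₀ (t₀ + 1),
      0 < (c t ^ n * Complex.exp (2 * Real.pi * Complex.I * t) * K).re) : n = 1 := by
  have h2 : t₀ ∈ Icc t₀ (t₀ + 1) := ⟨le_rfl, by linarith⟩
  have h3 : t₀ + 1 ∈ Icc t₀ (t₀ + 1) := ⟨by linarith, le_rfl⟩
  have hn' : (n : ℂ) ≠ 0 := Nat.cast_ne_zero.2 hn.ne'
  let P : ℝ → ℂ := fun t => c t ^ n * Complex.exp (2 * Real.pi * Complex.I * t) * K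
  have hPc : ContinuousOn P (Icc t₀ (t₀ + 1)) :=
    ((hc.pow n).mul (by fun_prop)).mul continuousOn_const
  have hP0 : ∀ t ∈ Icc t₀ (t₀ + 1), P t ≠ 0 := fun t ht h0 => by
    have := hre t ht
    rw [show c t ^ n * _ * K = 0 from h0] at this
    exact lt_irrefl _ this
  have hK : K ≠ 0 := right_ne_zero_of_mul (hP0 _ h2)
  -- `P` stays in the right half-plane, so its principal logarithm is continuous and takes equal
  -- values at the two ends.
  let l : ℝ → ℂ := fun t => Complex.log (P t)
  have hlc : ContinuousOn l (Icc t₀ (t₀ + 1)) := hPc.clog fun t ht => Or.inl (hre t ht)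
  -- An explicit continuous n-th root of `c ^ n * K`. It is `c` times a constant, so it closes up
  -- like `c`; but by its formula it is multiplied by exp(-2πi/n) over one turn.
  let β : ℝ → ℂ := fun t => Complex.exp ((l t - 2 * Real.pi * Complex.I * t) / n)
  have hβn : ∀ t ∈ Icc t₀ (t₀ + 1), β t ^ n = c t ^ n * K := fun t ht => by
    simp only [β, l]
    rw [← Complex.exp_nat_mul, mul_div_cancel₀ _ hn', Complex.exp_sub, Complex.exp_log (hP0 t ht)]
    simp only [P]
    field_simp
  have hratio : c (t₀ + 1) / β (t₀ + 1) = c t₀ / β t₀ := by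
    refine isPreconnected_Icc.constant_of_mapsTo (isDiscrete_setOf_pow_eq hn K⁻¹)
      (f := fun t => c t / β t) (hc.div (Complex.continuous_exp.comp_continuousOn
        ((hlc.sub (by fun_prop)).div_const _)) fun t _ => Complex.exp_ne_zero _) (fun t ht => ?_) h3 h2
    have h4 : c t ^ n ≠ 0 := left_ne_zero_of_mul (left_ne_zero_of_mul (hP0 t ht))
    change (c t / β t) ^ n = K⁻¹
    rw [div_pow, hβn t ht]
    field_simp
  have hexp : Complex.exp (2 * Real.pi * Complex.I * (t₀ + 1 : ℝ)) =
      Complex.exp (2 * Real.pi * Complex.I * t₀) := by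
    rw [Complex.ofReal_add, mul_add, Complex.ofReal_one, mul_one, Complex.exp_add,
      Complex.exp_two_pi_mul_I, mul_one]
  have hl : l (t₀ + 1) = l t₀ := by simp only [l, P, hloop, hexp]
  have hc0 : c t₀ ≠ 0 := fun h0 => hP0 t₀ h2 (by simp [P, h0, hn.ne'])
  have hβ : β (t₀ + 1) = β t₀ := by
    rw [hloop] at hratio
    rwa [div_eq_div_iff (Complex.exp_ne_zero _) (Complex.exp_ne_zero _), mul_right_inj' hc0,
      eq_comm] at hratio
  simp only [β, hl] at hβ
  obtain ⟨m, hm⟩ := Complex.exp_eq_exp_iff_exists_int.1 hβ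
  have hm' : (-1 : ℂ) = n * m := by
    have hpi : (2 * Real.pi * Complex.I : ℂ) ≠ 0 := Complex.two_pi_I_ne_zero
    field_simp at hm
    push_cast at hm
    have : (2 * Real.pi * Complex.I : ℂ) * (-1) = (2 * Real.pi * Complex.I) * (n * m) := by
      linear_combination hm
    exact mul_left_cancel₀ hpi this
  have hm'' : (-1 : ℤ) = n * m := by exact_mod_cast hm'
  have : (n : ℤ) ∣ 1 := ⟨-m, by linarith⟩
  exact_mod_cast Int.eq_one_of_dvd_one (by positivity) this

end Winding

/-! ### An embedded end has a simple pole -/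

section EmbeddedEnd

variable {ε : ℝ} {F G : ℂ → ℂ}

theorem tendsto_quotient {n : ℕ} {b : ℂ} {e : ℂ → ℂ} (he : AnalyticAt ℂ e 0)
    (he0 : e 0 ≠ 0) (hGe : ∀ᶠ z in 𝓝[≠] (0 : ℂ), z ^ n * G z = e z)
    (hH : Tendsto (fun z => z ^ n * (F z - b * G z)) (𝓝[≠] 0) (𝓝 0)) :
    Tendsto (fun z => F z / G z) (𝓝[≠] 0) (𝓝 b) := by
  have hel : Tendsto e (𝓝[≠] 0) (𝓝 (e 0)) :=
    he.continuousAt.tendsto.mono_left nhdsWithin_le_nhds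
  have h1 := (hH.div hel he0).add_const b
  rw [zero_div, zero_add] at h1
  refine h1.congr' ?_
  filter_upwards [hGe, hel.eventually_ne he0, self_mem_nhdsWithin] with z h2 h3 hz
  have hz : z ^ n ≠ 0 := pow_ne_zero _ hz
  have hG0 : G z ≠ 0 := right_ne_zero_of_mul (h2 ▸ h3)
  simp only [Pi.div_apply]
  rw [← h2]
  field_simp
  ring

theorem norm_planar_ge {f g : ℂ} {q : ℝ} (h : ‖f / g‖ ≤ q) (hg : g ≠ 0) :
    (1 - q) * ‖g‖ ≤ ‖g + conj f‖ := by
  have h1 : ‖f‖ ≤ q * ‖g‖ := by rwa [norm_div, div_le_iff₀ (norm_pos_iff.2 hg)] at h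
  have h2 := norm_sub_le_norm_add g (conj f)
  rw [RCLike.norm_conj] at h2
  linarith

/-- For |b| < q < 1, |F/G| is eventually below q, so |G + conj F| ≥ (1 - q)|G|. -/
theorem tendsto_cobounded_planar {n : ℕ} (hn : 0 < n) {b : ℂ} (hb : ‖b‖ < 1) {e : ℂ → ℂ}
    (he : AnalyticAt ℂ e 0) (he0 : e 0 ≠ 0) (hGe : ∀ᶠ z in 𝓝[≠] (0 : ℂ), z ^ n * G z = e z)
    (hH : Tendsto (fun z => z ^ n * (F z - b * G z)) (𝓝[≠] 0) (𝓝 0)) :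
    Tendsto (fun z => G z + conj (F z)) (𝓝[≠] 0) (Bornology.cobounded ℂ) := by
  obtain ⟨q, hbq, hq⟩ := exists_between hb
  have hel : Tendsto e (𝓝[≠] 0) (𝓝 (e 0)) :=
    he.continuousAt.tendsto.mono_left nhdsWithin_le_nhds
  rw [← tendsto_norm_atTop_iff_cobounded]
  have h0 : Tendsto (fun z : ℂ => ‖z ^ n‖) (𝓝[≠] 0) (𝓝[>] 0) := by
    refine tendsto_nhdsWithin_iff.2 ⟨?_, ?_⟩
    · have : Tendsto (fun z : ℂ => ‖z ^ n‖) (𝓝 0) (𝓝 ‖(0 : ℂ) ^ n‖) :=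
        (by fun_prop : Continuous fun z : ℂ => ‖z ^ n‖).tendsto 0
      rw [zero_pow hn.ne', norm_zero] at this
      exact this.mono_left nhdsWithin_le_nhds
    · filter_upwards [self_mem_nhdsWithin] with z hz
      exact norm_pos_iff.2 (pow_ne_zero _ hz)
  have h1 : Tendsto (fun z => (1 - q) * (‖e z‖ * ‖z ^ n‖⁻¹)) (𝓝[≠] 0) atTop :=
    (hel.norm.pos_mul_atTop (norm_pos_iff.2 he0) (tendsto_inv_nhdsGT_zero.comp h0)).const_mul_atTop
      (sub_pos.2 hq)
  refine tendsto_atTop_mono' _ ?_ h1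
  filter_upwards [hGe, (tendsto_quotient he he0 hGe hH).norm.eventually_lt_const hbq,
    hel.eventually_ne he0, self_mem_nhdsWithin] with z h2 h3 h4 hz
  have hz : z ^ n ≠ 0 := pow_ne_zero _ hz
  rw [← h2] at h4 ⊢
  refine le_trans (le_of_eq ?_) (norm_planar_ge h3.le (right_ne_zero_of_mul h4))
  rw [norm_mul]
  have := norm_ne_zero_iff.2 hz
  field_simp

/-- At an end where the height separates the sheets of the planar part, the planar part has a
simple pole. -/
theorem pole_order_eq_one_of_injOn (hF : DifferentiableOn ℂ F (PDisk ε))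
    (hG : DifferentiableOn ℂ G (PDisk ε)) (hne : ∀ z ∈ PDisk ε, ‖deriv F z‖ ≠ ‖deriv G z‖)
    {n : ℕ} (hn : 0 < n) {b : ℂ} (hb : ‖b‖ < 1) {e : ℂ → ℂ}
    (he : AnalyticAt ℂ e 0) (he0 : e 0 ≠ 0) (hGe : ∀ᶠ z in 𝓝[≠] (0 : ℂ), z ^ n * G z = e z)
    (hH : Tendsto (fun z => z ^ n * (F z - b * G z)) (𝓝[≠] 0) (𝓝 0))
    {x : ℂ → ℝ} {δ : ℝ} (hδ : 0 < δ) (hδε : δ ≤ ε) (hx : ContinuousOn x (PDisk δ))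
    (hinj : InjOn (fun z => (G z + conj (F z), x z)) (PDisk δ)) : n = 1 := by
  have hel : Tendsto e (𝓝[≠] 0) (𝓝 (e 0)) :=
    he.continuousAt.tendsto.mono_left nhdsWithin_le_nhds
  -- a punctured disk on which the planar part is close to its leading term
  have hre : ∀ᶠ z in 𝓝[≠] (0 : ℂ), 0 < (z ^ n * (G z + conj (F z)) * (e 0)⁻¹).re := by
    have hlim : Tendsto (fun z => ‖e z * (e 0)⁻¹ * (1 + conj (F z) / G z) -
        (1 + conj (F z) / G z)‖) (𝓝[≠] 0) (𝓝 0) := by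
      have h1 : Tendsto (fun z => ‖e z * (e 0)⁻¹ - 1‖) (𝓝[≠] 0) (𝓝 0) := by
        have := ((hel.mul_const (e 0)⁻¹).sub_const 1).norm
        rwa [mul_inv_cancel₀ he0, sub_self, norm_zero] at this
      have h2 : ∀ᶠ z in 𝓝[≠] (0 : ℂ), ‖F z / G z‖ < 1 :=
        (tendsto_quotient he he0 hGe hH).norm.eventually_lt_const hb
      refine squeeze_zero_norm' ?_ (by simpa using h1.mul_const 2)
      filter_upwards [h2] with z hz
      have h3 : ‖1 + conj (F z) / G z‖ ≤ 2 := by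
        refine (norm_add_le _ _).trans ?_
        rw [norm_one, norm_div, RCLike.norm_conj, ← norm_div]
        linarith
      have h4 : e z * (e 0)⁻¹ * (1 + conj (F z) / G z) - (1 + conj (F z) / G z) =
        (e z * (e 0)⁻¹ - 1) * (1 + conj (F z) / G z) := by ring
      rw [norm_norm, h4, norm_mul]
      exact mul_le_mul_of_nonneg_left h3 (norm_nonneg _)
    obtain ⟨q, hbq, hq⟩ := exists_between hb
    filter_upwards [hGe, (tendsto_quotient he he0 hGe hH).norm.eventually_lt_const hbq,
      hlim.eventually_lt_const (sub_pos.2 hq), hel.eventually_ne he0, self_mem_nhdsWithin]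
      with z h1 h2 h3 h4 hz
    have hz : z ^ n ≠ 0 := pow_ne_zero _ hz
    have hG0 : G z ≠ 0 := by
      rw [← h1] at h4; exact right_ne_zero_of_mul h4
    -- The factor `1 + conj (F z) / G z` has real part above `1 - q`, and replacing `e z * (e 0)⁻¹`
    -- by 1 costs less than `1 - q`.
    have h5 : z ^ n * (G z + conj (F z)) * (e 0)⁻¹ = e z * (e 0)⁻¹ * (1 + conj (F z) / G z) := by
      rw [← h1]; field_simp
    rw [h5]
    have h6 : ‖conj (F z) / G z‖ < q := by
      rwa [norm_div, RCLike.norm_conj, ← norm_div]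
    have h7 := (abs_le.1 (Complex.abs_re_le_norm (conj (F z) / G z))).1
    have h8 := (abs_le.1 (Complex.abs_re_le_norm (e z * (e 0)⁻¹ * (1 + conj (F z) / G z) -
        (1 + conj (F z) / G z)))).1
    simp only [Complex.sub_re, Complex.add_re, Complex.one_re] at h7 h8
    linarith
  obtain ⟨r', hr'0, hr'δ, hr're⟩ := exists_pdisk_of_eventually hre hδ
  obtain ⟨r, hr0, hr⟩ := exists_between hr'0
  have hrδ : r < δ := hr.trans_le hr'δ
  have hrε : r < ε := hrδ.trans_le hδε
  let f : ℂ → ℂ := fun z => G z + conj (F z)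
  have hloc : IsLocalHomeomorphOn f (PDisk ε) := isLocalHomeomorphOn_planar (isOpen_pdisk ε) hF hG hne
  have hfc : ContinuousOn f (PDisk ε) := hloc.continuousOn
  have hp : IsLocalHomeomorph (fun z : PDisk r => f z) :=
    isLocalHomeomorph_domRestrict (isOpen_pdisk r) (hloc.mono (pdisk_mono hrε.le))
  have hinf := tendsto_cobounded_planar hn hb he he0 hGe hH
  rw [← tendsto_norm_atTop_iff_cobounded] at hinf
  have hsph : Metric.sphere (0 : ℂ) r ⊆ PDisk ε := fun z hz => by
    have : ‖z‖ = r := by simpa using hz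
    exact ⟨this ▸ hr0, this ▸ hrε⟩
  obtain ⟨M, hM⟩ := (isCompact_sphere (0 : ℂ) r).exists_bound_of_continuousOn (hfc.mono hsph)
  -- `‖f‖ ≤ M < R` on the outer circle and `f` tends to infinity at 0, so the level set `‖f‖ = R`
  -- stays away from both ends of `PDisk r`.
  obtain ⟨x₀, hx₀M, hx₀⟩ := ((hinf.eventually_gt_atTop M).and (pdisk_mem_nhdsNE hr0)).exists
  set R : ℝ := ‖f x₀‖ with hR
  -- the preimage of the circle through `f x₀` is compact
  have hcpt : IsCompact {y : PDisk r | ‖f y‖ = R} := by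
    obtain ⟨η, hη0, -, hη⟩ := exists_pdisk_of_eventually (hinf.eventually_gt_atTop R) hr0
    rw [Topology.IsEmbedding.subtypeVal.isCompact_iff]
    have hA : IsCompact (Metric.closedBall (0 : ℂ) r ∩ {z | η ≤ ‖z‖}) :=
      (isCompact_closedBall 0 r).inter_right (isClosed_le continuous_const continuous_norm)
    have hAε : Metric.closedBall (0 : ℂ) r ∩ {z | η ≤ ‖z‖} ⊆ PDisk ε := fun z hz =>
      ⟨hη0.trans_le hz.2, (mem_closedBall_zero_iff.1 hz.1).trans_lt hrε⟩
    have hB := hA.inter_right ((hfc.mono hAε).norm.preimage_isClosed_of_isClosed hA.isClosed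
      (isClosed_singleton (x := R)))
    convert hB using 1
    ext z
    constructor
    · rintro ⟨y, hy, rfl⟩
      have hyη : η ≤ ‖(y : ℂ)‖ := by
        by_contra hlt
        exact absurd hy (hη y ⟨y.2.1, not_le.1 hlt⟩).ne'
      have hyA : (y : ℂ) ∈ Metric.closedBall (0 : ℂ) r ∩ {z | η ≤ ‖z‖} :=
        ⟨mem_closedBall_zero_iff.2 y.2.2.le, hyη⟩
      exact ⟨hyA, hyA, hy⟩
    · rintro ⟨hzA, -, hz⟩
      have hz : ‖f z‖ = R := hz
      have hzr : ‖z‖ ≠ r := fun h => by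
        have h1 : ‖f z‖ ≤ M := hM z (mem_sphere_zero_iff_norm.2 h)
        rw [hz] at h1
        exact absurd hx₀M (not_lt.2 h1)
      exact ⟨⟨z, hη0.trans_le hzA.2, (mem_closedBall_zero_iff.1 hzA.1).lt_of_ne hzr⟩, hz, rfl⟩
  have hfin : {y : PDisk r | f y = f x₀}.Finite := by
    refine IsCompact.finite (hcpt.of_isClosed_subset
      (isClosed_singleton.preimage hp.continuous) fun y hy => ?_) ?_
    · rw [mem_ofPred, show f y = f x₀ from hy]
    · refine hp.isLocalHomeomorphOn.isDiscrete_of_image (s := {y : PDisk r | f y = f x₀})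
        (Subsingleton.isDiscrete ?_)
      rintro _ ⟨y, hy, rfl⟩ _ ⟨y', hy', rfl⟩
      exact Eq.trans hy (Eq.symm hy')
  -- More turns than the fibre has points; the `+ 1` also makes `N` positive at once.
  set N := Nat.card {y : PDisk r | f y = f x₀} + 1 with hN
  have hN0 : (0 : ℝ) < N := by positivity
  obtain ⟨γ, hγc, hγ0, hγl⟩ := exists_lift hp
    (σ := fun t : ℝ => f x₀ * Complex.exp (2 * Real.pi * Complex.I * (N * t : ℝ)))
    (e₀ := ⟨x₀, hx₀⟩) (by fun_prop) (by simp) (by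
      intro T hT γ hγ _ hγl
      refine exists_tendsto_lift hp (σ := fun t : ℝ =>
        f x₀ * Complex.exp (2 * Real.pi * Complex.I * (N * t : ℝ))) (by fun_prop) hT.1 hγ hγl hcpt ?_
      filter_upwards [Ioo_mem_nhdsLT hT.1] with t ht
      have h1 : f (γ t) = _ := hγl t ⟨ht.1.le, ht.2⟩
      rw [h1, norm_mul, show 2 * Real.pi * Complex.I * ((N * t : ℝ) : ℂ) =
        ((2 * Real.pi * (N * t) : ℝ) : ℂ) * Complex.I by push_cast; ring,
        Complex.norm_exp_ofReal_mul_I, mul_one])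
  -- Reparametrized so that a unit of time is one turn.
  let Γ : ℝ → ℂ := fun t => γ (t / N)
  have hmapN : MapsTo (fun t : ℝ => t / N) (Icc 0 N) (Icc 0 1) := fun t ht =>
    ⟨div_nonneg ht.1 hN0.le, (div_le_one hN0).2 ht.2⟩
  have hΓc : ContinuousOn Γ (Icc 0 N) :=
    continuous_subtype_val.comp_continuousOn (hγc.comp (by fun_prop) hmapN)
  have hΓr : ∀ t, Γ t ∈ PDisk r := fun t => (γ (t / N)).2
  have hΓl : ∀ t ∈ Icc (0 : ℝ) N, f (Γ t) = f x₀ * Complex.exp (2 * Real.pi * Complex.I * t) := by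
    intro t ht
    have h1 : f (Γ t) = _ := hγl (t / N) (hmapN ht)
    rw [h1, mul_div_cancel₀ _ hN0.ne']
  -- A lift that closes after one turn gives `n = 1` by winding. Otherwise injectivity makes the
  -- heights one turn apart always different, and their difference keeps a constant sign.
  by_cases hcase : ∃ t ∈ Icc (0 : ℝ) (N - 1), Γ (t + 1) = Γ t
  · obtain ⟨t₀, ht₀, hloop⟩ := hcase
    have hsub : Icc t₀ (t₀ + 1) ⊆ Icc (0 : ℝ) N := fun t ht =>
      ⟨ht₀.1.trans ht.1, by linarith [ht.2, ht₀.2]⟩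
    refine eq_one_of_loop hn (hΓc.mono hsub) hloop (K := f x₀ * (e 0)⁻¹) fun t ht => ?_
    have h1 := hr're (Γ t) (pdisk_mono hr.le (hΓr t))
    rw [show G (Γ t) + conj (F (Γ t)) = _ from hΓl t (hsub ht)] at h1
    convert h1 using 2
    ring
  · exfalso
    push Not at hcase
    have hmap1 : MapsTo (fun t : ℝ => t + 1) (Icc 0 (N - 1)) (Icc 0 N) := fun t ht =>
      ⟨by linarith [ht.1], by linarith [ht.2]⟩
    have hmap0 : Icc (0 : ℝ) (N - 1) ⊆ Icc 0 N := Icc_subset_Icc_right (by linarith)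
    have hxΓ : ContinuousOn (fun t => x (Γ t)) (Icc 0 N) :=
      hx.comp hΓc fun t _ => pdisk_mono hrδ.le (hΓr t)
    let u : ℝ → ℝ := fun t => x (Γ (t + 1)) - x (Γ t)
    have huc : ContinuousOn u (Icc 0 (N - 1)) :=
      (hxΓ.comp (by fun_prop) hmap1).sub (hxΓ.mono hmap0)
    have hu0 : ∀ t ∈ Icc (0 : ℝ) (N - 1), u t ≠ 0 := by
      intro t ht h0
      refine hcase t ht (hinj (pdisk_mono hrδ.le (hΓr _)) (pdisk_mono hrδ.le (hΓr _)) ?_)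
      refine Prod.ext ?_ (sub_eq_zero.1 h0)
      change f (Γ (t + 1)) = f (Γ t)
      rw [hΓl _ (hmap1 ht), hΓl _ (hmap0 ht), Complex.ofReal_add, mul_add, Complex.ofReal_one,
        mul_one, Complex.exp_add, Complex.exp_two_pi_mul_I, mul_one]
    obtain ⟨s, hs⟩ : ∃ s : ℝ, ∀ t ∈ Icc (0 : ℝ) (N - 1), 0 < s * u t := by
      have h0 : (0 : ℝ) ∈ Icc (0 : ℝ) (N - 1) := ⟨le_rfl, by simp [hN]⟩
      rcases (hu0 0 h0).lt_or_gt with h | h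
      · refine ⟨-1, fun t ht => ?_⟩
        by_contra hle
        obtain ⟨y, hy, hy0⟩ := isPreconnected_Icc.intermediate_value h0 ht huc
          (show (0 : ℝ) ∈ Icc (u 0) (u t) from ⟨h.le, by linarith⟩)
        exact hu0 y hy hy0
      · refine ⟨1, fun t ht => ?_⟩
        by_contra hle
        obtain ⟨y, hy, hy0⟩ := isPreconnected_Icc.intermediate_value ht h0 huc
          (show (0 : ℝ) ∈ Icc (u t) (u 0) from ⟨by linarith, h.le⟩)
        exact hu0 y hy hy0
    -- The points `Γ 0, ..., Γ N` lie over `f x₀`, and monotone heights make them distinct: too many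
    -- for the fibre.
    let a : Fin (N + 1) → ℝ := fun j => s * x (Γ j)
    have ha : StrictMono a := Fin.strictMono_iff_lt_succ.2 fun j => by
      have hj : ((j : ℕ) : ℝ) ∈ Icc (0 : ℝ) (N - 1) := by
        have : ((j : ℕ) : ℝ) + 1 ≤ N := by exact_mod_cast j.2
        exact ⟨by positivity, by linarith⟩
      have := hs _ hj
      simp only [u, mul_sub] at this
      simp only [a, Fin.val_castSucc, Fin.val_succ, Nat.cast_add, Nat.cast_one]
      linarith
    have hfib : ∀ j : Fin (N + 1), f (Γ j) = f x₀ := fun j => by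
      rw [hΓl _ ⟨by positivity, by exact_mod_cast Nat.lt_succ_iff.1 j.2⟩,
        show 2 * Real.pi * Complex.I * (((j : ℕ) : ℝ) : ℂ) = (j : ℕ) * (2 * Real.pi * Complex.I) by
          push_cast; ring, Complex.exp_nat_mul_two_pi_mul_I, mul_one]
    have := hfin.to_subtype
    have hcard := Nat.card_le_card_of_injective
      (β := ↑{y : PDisk r | f y = f x₀}) (fun j : Fin (N + 1) => ⟨⟨Γ j, hΓr j⟩, hfib j⟩)
      fun i j hij => ha.injective (by
        have : Γ i = Γ j := congrArg Subtype.val (congrArg Subtype.val hij)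
        simp only [a, this])
    rw [Nat.card_eq_fintype_card, Fintype.card_fin] at hcard
    omega

end EmbeddedEnd

/-! ### A simple pole gives an embedded end -/

section SimplePole

variable {ε : ℝ} {F G : ℂ → ℂ} {ψ : ℂ → Space}

theorem exists_analytic_remainder (hε : 0 < ε) (hF : DifferentiableOn ℂ F (PDisk ε))
    (hG : DifferentiableOn ℂ G (PDisk ε)) {b : ℂ}
    (hH : Tendsto (fun z => z ^ 1 * (F z - b * G z)) (𝓝[≠] 0) (𝓝 0)) :
    ∃ k : ℂ → ℂ, AnalyticAt ℂ k 0 ∧ ∀ᶠ z in 𝓝[≠] (0 : ℂ), F z = b * G z + k z := by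
  obtain ⟨k, hk, hFk⟩ := exists_analyticAt_of_tendsto_mul (f := fun z => F z - b * G z)
    (by
      filter_upwards [pdisk_mem_nhdsNE hε] with z hz
      have hn := (isOpen_pdisk ε).mem_nhds hz
      exact (hF.differentiableAt hn).sub ((hG.differentiableAt hn).const_mul b))
    (by simpa using hH)
  exact ⟨k, hk, hFk.mono fun z hz => by rw [← hz]; ring⟩

theorem hasStrictDerivAt_div_of_ne_zero {e : ℂ → ℂ} (he : AnalyticAt ℂ e 0) (he0 : e 0 ≠ 0) :
    HasStrictDerivAt (fun z => z / e z) (e 0)⁻¹ 0 := by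
  have h := (hasStrictDerivAt_id (0 : ℂ)).div he.hasStrictDerivAt he0
  refine h.congr_deriv ?_
  simp only [id, zero_mul, one_mul, sub_zero]
  field_simp

/-- The planar part of a front with a simple pole is injective near the end. -/
theorem exists_injOn_planar {b : ℂ} (hb : ‖b‖ < 1) {e k : ℂ → ℂ} (he : AnalyticAt ℂ e 0)
    (he0 : e 0 ≠ 0) (hk : AnalyticAt ℂ k 0) (hGe : ∀ᶠ z in 𝓝[≠] (0 : ℂ), z * G z = e z)
    (hFk : ∀ᶠ z in 𝓝[≠] (0 : ℂ), F z = b * G z + k z) (hε : 0 < ε) :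
    ∃ δ, 0 < δ ∧ δ ≤ ε ∧ InjOn (fun z => G z + conj (F z)) (PDisk δ) := by
  set c : ℝ := ‖(e 0)⁻¹‖ / 2 with hc
  have hc0 : 0 < c := half_pos (norm_pos_iff.2 (inv_ne_zero he0))
  set K : ℝ := ‖deriv k 0‖ + 1 with hK
  have hK0 : 0 < K := by positivity
  -- `z / e z` is 1/G, with strict derivative `(e 0)⁻¹` at 0; `c` is half the modulus of the latter.
  have h1 : ∀ᶠ p : ℂ × ℂ in 𝓝 (0, 0), c * ‖p.1 - p.2‖ ≤ ‖p.1 / e p.1 - p.2 / e p.2‖ := by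
    filter_upwards [(hasStrictDerivAt_div_of_ne_zero he he0).hasStrictFDerivAt.isLittleO.def hc0]
      with p hp
    have h2 : ‖(e 0)⁻¹ * (p.1 - p.2)‖ = 2 * c * ‖p.1 - p.2‖ := by rw [norm_mul, hc]; ring
    have h3 := norm_sub_norm_le ((e 0)⁻¹ * (p.1 - p.2)) (p.1 / e p.1 - p.2 / e p.2)
    rw [norm_sub_rev ((e 0)⁻¹ * (p.1 - p.2)), h2] at h3
    simp only [ContinuousLinearMap.toSpanSingleton_apply, smul_eq_mul] at hp
    rw [mul_comm (p.1 - p.2)] at hp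
    linarith
  have h2 : ∀ᶠ p : ℂ × ℂ in 𝓝 (0, 0), ‖k p.1 - k p.2‖ ≤ K * ‖p.1 - p.2‖ := by
    filter_upwards [hk.hasStrictDerivAt.hasStrictFDerivAt.isLittleO.def zero_lt_one] with p hp
    simp only [ContinuousLinearMap.toSpanSingleton_apply, smul_eq_mul] at hp
    have h3 := norm_sub_norm_le (k p.1 - k p.2) ((p.1 - p.2) * deriv k 0)
    rw [norm_mul] at h3
    rw [hK]
    nlinarith
  have h3 : Tendsto (fun z => ‖z / e z‖) (𝓝 0) (𝓝 0) := by
    have := (hasStrictDerivAt_div_of_ne_zero he he0).hasDerivAt.continuousAt.norm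
    rwa [ContinuousAt, zero_div, norm_zero] at this
  obtain ⟨U, hU, hUall⟩ := (Filter.eventually_prod_self_iff' (la := 𝓝 (0 : ℂ))
    (r := fun p : ℂ × ℂ => c * ‖p.1 - p.2‖ ≤ ‖p.1 / e p.1 - p.2 / e p.2‖ ∧
      ‖k p.1 - k p.2‖ ≤ K * ‖p.1 - p.2‖)).1 (by rw [← nhds_prod_eq]; exact h1.and h2)
  -- The size of 1/G below which the Lipschitz bounds for 1/G and `k` contradict each other at a
  -- double point.
  have hpos : 0 < (1 - ‖b‖) * c / K := by
    have := sub_pos.2 hb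
    positivity
  obtain ⟨δ, hδ, hδε, hall⟩ := exists_pdisk_of_eventually (hGe.and (hFk.and (Filter.Eventually.and
    ((he.continuousAt.eventually_ne he0).filter_mono nhdsWithin_le_nhds)
    (((Filter.eventually_of_mem hU fun _ h => h).and ((h3.eventually_lt_const zero_lt_one).and
      (h3.eventually_lt_const hpos))).filter_mono nhdsWithin_le_nhds)))) hε
  refine ⟨δ, hδ, hδε, fun z hz w hw hzw => ?_⟩
  obtain ⟨hz1, hz2, hz3, hzU, hz4, hz5⟩ := hall z hz
  obtain ⟨hw1, hw2, hw3, hwU, hw4, hw5⟩ := hall w hw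
  obtain ⟨h4, h5⟩ := hUall z hzU w hwU
  by_contra hne
  have hz0 : z ≠ 0 := norm_pos_iff.1 hz.1
  have hw0 : w ≠ 0 := norm_pos_iff.1 hw.1
  have hGz : G z = e z / z := by rw [← hz1]; field_simp
  have hGw : G w = e w / w := by rw [← hw1]; field_simp
  -- Equal planar parts mean that G(z) - G(w) is minus the conjugate of F(z) - F(w), where F = bG +
  -- k.
  have h6 : (1 - ‖b‖) * ‖G z - G w‖ ≤ ‖k z - k w‖ := by
    have h7 : G z - G w = -conj (b * (G z - G w) + (k z - k w)) := by
      simp only [hz2, hw2] at hzw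
      simp only [map_add, map_mul, map_sub] at hzw ⊢
      linear_combination hzw
    have h8 := congrArg norm h7
    rw [norm_neg, RCLike.norm_conj] at h8
    have h9 := norm_add_le (b * (G z - G w)) (k z - k w)
    rw [← h8, norm_mul] at h9
    linarith
  have h7 : ‖z / e z - w / e w‖ = ‖G z - G w‖ * (‖z / e z‖ * ‖w / e w‖) := by
    rw [← norm_mul, ← norm_mul, norm_sub_rev, hGz, hGw]
    congr 1
    field_simp
  have hzw0 : 0 < ‖z - w‖ := norm_pos_iff.2 (sub_ne_zero.2 hne)
  have hb' := sub_pos.2 hb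
  have h8 : ‖z / e z‖ * ‖w / e w‖ < (1 - ‖b‖) * c / K :=
    lt_of_le_of_lt (mul_le_of_le_one_left (norm_nonneg _) hz4.le) hw5
  rw [lt_div_iff₀ hK0] at h8
  have h9 : (1 - ‖b‖) * (c * ‖z - w‖) ≤ K * ‖z - w‖ * (‖z / e z‖ * ‖w / e w‖) :=
    calc (1 - ‖b‖) * (c * ‖z - w‖)
        ≤ (1 - ‖b‖) * (‖G z - G w‖ * (‖z / e z‖ * ‖w / e w‖)) := by
          rw [← h7]; exact mul_le_mul_of_nonneg_left h4 hb'.le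
      _ = (1 - ‖b‖) * ‖G z - G w‖ * (‖z / e z‖ * ‖w / e w‖) := by ring
      _ ≤ _ := mul_le_mul_of_nonneg_right (h6.trans h5) (by positivity)
  nlinarith

theorem IsImproperAffineFront.contDiffOn {Ω : Set ℂ} (hΩ : IsOpen Ω)
    (h : IsImproperAffineFront Ω F G ψ) : ContDiffOn ℝ ∞ ψ Ω := by
  obtain ⟨k, hk, hψ⟩ := h.repr
  have hF : ContDiffOn ℝ ∞ F Ω := (h.holo_F.contDiffOn hΩ).restrict_scalars ℝ
  have hG : ContDiffOn ℝ ∞ G Ω := (h.holo_G.contDiffOn hΩ).restrict_scalars ℝ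
  have hk' := hk.contDiffOn hΩ h.holo_F h.holo_G
  refine ContDiffOn.congr ?_ hψ
  refine (WithLp.prodContinuousLinearEquiv 2 ℝ ℂ ℝ).symm.contDiff.comp_contDiffOn
    (ContDiffOn.prodMk (hG.add (Complex.conjCLE.contDiff.comp_contDiffOn hF)) ?_)
  exact ((((hG.norm_sq ℝ).sub (hF.norm_sq ℝ)).div_const 2).add
    (Complex.reCLM.contDiff.comp_contDiffOn (hG.mul hF))).sub (contDiffOn_const.mul hk')

theorem IsImproperAffineFront.fst_eq {Ω : Set ℂ} (h : IsImproperAffineFront Ω F G ψ) {z : ℂ}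
    (hz : z ∈ Ω) : (ψ z).fst = G z + conj (F z) := by
  obtain ⟨k, -, hψ⟩ := h.repr
  rw [hψ z hz]
  rfl

/-- An immersed front whose planar part is injective near the end has an embedded end. -/
theorem isEmbeddedEnd_of_injOn_planar (hψ : IsImproperAffineSphere (PDisk ε) F G ψ) {δ : ℝ}
    (hδ : 0 < δ) (hδε : δ ≤ ε) (hinj : InjOn (fun z => G z + conj (F z)) (PDisk δ)) :
    IsEmbeddedEnd ε ψ := by
  have hsub := pdisk_mono hδε
  have hs : ContDiffOn ℝ ∞ ψ (PDisk δ) :=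
    (hψ.toIsImproperAffineFront.contDiffOn (isOpen_pdisk ε)).mono hsub
  let L : Space →L[ℝ] ℂ := ContinuousLinearMap.fst ℝ ℂ ℝ ∘L
    (WithLp.prodContinuousLinearEquiv 2 ℝ ℂ ℝ).toContinuousLinearMap
  have hL : ∀ z ∈ PDisk ε, L (ψ z) = G z + conj (F z) := fun z hz =>
    hψ.toIsImproperAffineFront.fst_eq hz
  refine ⟨δ, hδ, hδε, hs, fun z hz => ?_, ?_⟩
  · have hn := (isOpen_pdisk ε).mem_nhds (hsub hz)
    have hd : HasFDerivAt ψ (fderiv ℝ ψ z) z :=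
      ((hs.contDiffAt ((isOpen_pdisk δ).mem_nhds hz)).differentiableAt (by simp)).hasFDerivAt
    have h1 := L.hasFDerivAt.comp z hd
    have h2 : HasFDerivAt (L ∘ ψ) (planarDeriv (deriv F z) (deriv G z)) z :=
      (hasStrictFDerivAt_planar (hψ.holo_F.analyticAt hn)
        (hψ.holo_G.analyticAt hn)).hasFDerivAt.congr_of_eventuallyEq (by
          filter_upwards [hn] with w hw using hL w hw)
    have h3 := h1.unique h2
    have h4 := planarDeriv_injective (hψ.nondegenerate z (hsub hz))
    rw [← h3, ContinuousLinearMap.coe_comp] at h4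
    exact h4.of_comp
  · have hp : IsLocalHomeomorph (fun z : PDisk δ => G z + conj (F z)) :=
      isLocalHomeomorph_domRestrict (isOpen_pdisk δ)
        ((isLocalHomeomorphOn_planar (isOpen_pdisk ε) hψ.holo_F hψ.holo_G
          hψ.nondegenerate).mono hsub)
    -- The planar part is a linear projection of `ψ`; since it is an embedding, so is `ψ`.
    have hemb := (hp.isOpenEmbedding_of_injective fun z w h =>
      Subtype.ext (hinj z.2 w.2 h)).isEmbedding
    have hcomp : (fun z : PDisk δ => G z + conj (F z)) = L ∘ (PDisk δ).domRestrict ψ :=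
      funext fun z => (hL z (hsub z.2)).symm
    rw [hcomp] at hemb
    exact IsEmbedding.of_comp hs.continuousOn.domRestrict L.continuous hemb

end SimplePole

/-! ### Injective holomorphic maps at a puncture -/

section Injective

/-- An injective holomorphic function has non-vanishing derivative. -/
theorem deriv_ne_zero_of_injOn {f : ℂ → ℂ} (hf : AnalyticAt ℂ f 0) (hf0 : f 0 = 0) {U : Set ℂ}
    (hU : U ∈ 𝓝 (0 : ℂ)) (hinj : InjOn f U) : deriv f 0 ≠ 0 := by
  obtain ⟨m, g, hg, hg0, hfg⟩ := hf.exists_eventuallyEq_pow_smul_nonzero_iff.2 fun h0 => by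
    obtain ⟨z, ⟨hz, hzU⟩, hz0⟩ := (((h0.and hU).filter_mono nhdsWithin_le_nhds).and
      (self_mem_nhdsWithin (a := (0 : ℂ)) (s := {0}ᶜ))).exists
    exact hz0 (hinj hzU (mem_of_mem_nhds hU) (hz.trans hf0.symm))
  have hm : 0 < m := by
    rcases Nat.eq_zero_or_pos m with rfl | h
    · have := hfg.self_of_nhds
      rw [hf0] at this
      exact absurd (by simpa using this.symm) hg0
    · exact h
  have hm0 : (m : ℂ) ≠ 0 := Nat.cast_ne_zero.2 hm.ne'
  obtain ⟨C, hC⟩ := IsAlgClosed.exists_pow_nat_eq (g 0) hm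
  have hC0 : C ≠ 0 := fun h => hg0 (by rw [← hC, h, zero_pow hm.ne'])
  -- a local coordinate whose `m`-th power is `f`
  let χ : ℂ → ℂ := fun z => z * (C * Complex.exp (Complex.log (g z / g 0) / m))
  have hχa : AnalyticAt ℂ χ 0 := by
    refine analyticAt_id.mul (analyticAt_const.mul (AnalyticAt.cexp (AnalyticAt.div_const ?_)))
    refine AnalyticAt.clog (hg.div_const) ?_
    rw [div_self hg0]
    exact Complex.one_mem_slitPlane
  have hχd : deriv χ 0 ≠ 0 := by
    have h1 : AnalyticAt ℂ (fun z => C * Complex.exp (Complex.log (g z / g 0) / m)) 0 := by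
      refine analyticAt_const.mul (AnalyticAt.cexp (AnalyticAt.div_const ?_))
      refine AnalyticAt.clog (hg.div_const) ?_
      rw [div_self hg0]
      exact Complex.one_mem_slitPlane
    have h2 := ((hasDerivAt_id (0 : ℂ)).mul h1.differentiableAt.hasDerivAt).deriv
    have h3 : deriv χ 0 = _ := h2
    rw [h3]
    simp [hC0, hg0]
  have hχm : ∀ᶠ z in 𝓝 (0 : ℂ), χ z ^ m = f z := by
    filter_upwards [hfg, hg.continuousAt.eventually_ne hg0] with z hz hgz
    rw [hz, sub_zero, smul_eq_mul, mul_pow, mul_pow, hC, ← Complex.exp_nat_mul,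
      mul_div_cancel₀ _ hm0, Complex.exp_log (div_ne_zero hgz hg0), mul_div_cancel₀ _ hg0]
  have hmap := hχa.hasStrictDerivAt.map_nhds_eq hχd
  have hχ0 : χ 0 = 0 := by simp [χ]
  rw [hχ0] at hmap
  have himg : χ '' (U ∩ {z | χ z ^ m = f z}) ∈ 𝓝 (0 : ℂ) :=
    hmap ▸ image_mem_map (inter_mem hU hχm)
  -- The points with coordinates `t` and `ξ * t` have the same value under `f`, so injectivity
  -- forces this primitive m-th root of unity to be 1.
  set ξ : ℂ := Complex.exp (2 * Real.pi * Complex.I / m) with hξ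
  have hξ1 : ξ ^ m = 1 := by
    rw [hξ, ← Complex.exp_nat_mul, mul_div_cancel₀ _ hm0, Complex.exp_two_pi_mul_I]
  have himg' : ∀ᶠ t in 𝓝 (0 : ℂ), ξ * t ∈ χ '' (U ∩ {z | χ z ^ m = f z}) := by
    have : Tendsto (fun t : ℂ => ξ * t) (𝓝 0) (𝓝 0) := by
      simpa using (continuous_const_mul ξ).tendsto (0 : ℂ)
    exact this himg
  obtain ⟨t, ⟨ht1, ht2⟩, ht0⟩ := (((Filter.Eventually.and himg himg').filter_mono
    nhdsWithin_le_nhds).and (self_mem_nhdsWithin (a := (0 : ℂ)) (s := {0}ᶜ))).exists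
  have ht0 : t ≠ 0 := ht0
  obtain ⟨z, ⟨hzU, hz⟩, hzt⟩ := ht1
  obtain ⟨w, ⟨hwU, hw⟩, hwt⟩ := ht2
  have hzw : z = w := hinj hzU hwU (by
    rw [← show χ z ^ m = f z from hz, ← show χ w ^ m = f w from hw, hzt, hwt, mul_pow, hξ1,
      one_mul])
  have hξ' : ξ = 1 := by
    rw [← hzw, hzt] at hwt
    exact mul_right_cancel₀ ht0 (by rw [one_mul]; exact hwt.symm)
  have hm1 : m = 1 := by
    have := (Complex.isPrimitiveRoot_exp m hm.ne').eq_orderOf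
    rw [← hξ, hξ', orderOf_one] at this
    exact this
  have h5 : deriv χ 0 = deriv f 0 := Filter.EventuallyEq.deriv_eq (by
    filter_upwards [hχm] with z hz
    rw [← hz, hm1, pow_one])
  rwa [← h5]

variable {δ : ℝ} {φ : ℂ → ℂ}

/-- As φ has no zeros, its extension by 0 at the puncture is still injective, so the zero there is
simple. -/
theorem exists_inv_norm_le_of_injOn (hδ : 0 < δ) (hφ : DifferentiableOn ℂ φ (PDisk δ))
    (hinj : InjOn φ (PDisk δ)) (hφ0 : ∀ z ∈ PDisk δ, φ z ≠ 0) (hlim : Tendsto φ (𝓝[≠] 0) (𝓝 0)) :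
    ∃ K, ∀ᶠ z in 𝓝[≠] (0 : ℂ), ‖φ z‖⁻¹ ≤ K / ‖z‖ := by
  obtain ⟨k, hk, hφk⟩ := exists_analyticAt_of_tendsto_mul (f := φ)
    (by
      filter_upwards [pdisk_mem_nhdsNE hδ] with z hz
      exact hφ.differentiableAt ((isOpen_pdisk δ).mem_nhds hz))
    (by simpa using (tendsto_id.mono_left nhdsWithin_le_nhds).mul hlim)
  have hk0 : k 0 = 0 := tendsto_nhds_unique (hk.continuousAt.tendsto.mono_left nhdsWithin_le_nhds)
    (hlim.congr' hφk)
  obtain ⟨r, hr, hrδ, hrall⟩ := exists_pdisk_of_eventually hφk hδ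
  have hmem : ∀ z ∈ Metric.ball (0 : ℂ) r, z ≠ 0 → z ∈ PDisk r := fun z hz h0 =>
    ⟨norm_pos_iff.2 h0, by simpa using hz⟩
  have hkinj : InjOn k (Metric.ball 0 r) := by
    intro z hz w hw hzw
    by_cases hz0 : z = 0 <;> by_cases hw0 : w = 0
    · rw [hz0, hw0]
    · rw [hz0, hk0, ← hrall w (hmem w hw hw0)] at hzw
      exact absurd hzw.symm (hφ0 w (pdisk_mono hrδ (hmem w hw hw0)))
    · rw [hw0, hk0, ← hrall z (hmem z hz hz0)] at hzw
      exact absurd hzw (hφ0 z (pdisk_mono hrδ (hmem z hz hz0)))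
    · rw [← hrall z (hmem z hz hz0), ← hrall w (hmem w hw hw0)] at hzw
      exact hinj (pdisk_mono hrδ (hmem z hz hz0)) (pdisk_mono hrδ (hmem w hw hw0)) hzw
  have hd := deriv_ne_zero_of_injOn hk hk0 (Metric.ball_mem_nhds 0 hr) hkinj
  have hslope := (hasDerivAt_iff_tendsto_slope.1 hk.differentiableAt.hasDerivAt).norm
  have hpos := norm_pos_iff.2 hd
  refine ⟨(‖deriv k 0‖ / 2)⁻¹, ?_⟩
  filter_upwards [hslope.eventually_const_lt (half_lt_self hpos), hφk, self_mem_nhdsWithin]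
    with z h1 h2 hz
  have hz : 0 < ‖z‖ := norm_pos_iff.2 hz
  rw [slope_def_field, hk0, sub_zero, sub_zero, norm_div, lt_div_iff₀ hz, ← h2] at h1
  rw [← one_div, ← one_div, div_div, div_le_div_iff_of_pos_left one_pos (lt_trans (by positivity) h1)
    (by positivity)]
  exact h1.le

/-- An injective holomorphic function without zeros on a punctured disk that approaches `0` or `∞`
at the puncture does so at the rate of `z` or of `1 / z`. -/
theorem exists_norm_le_of_injOn (hδ : 0 < δ) (hφ : DifferentiableOn ℂ φ (PDisk δ))
    (hinj : InjOn φ (PDisk δ)) (hφ0 : ∀ z ∈ PDisk δ, φ z ≠ 0)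
    (hlim : Tendsto (fun z => ‖φ z‖⁻¹ + ‖φ z‖) (𝓝[≠] 0) atTop) :
    ∃ K, ∀ᶠ z in 𝓝[≠] (0 : ℂ), ‖φ z‖⁻¹ + ‖φ z‖ ≤ K / ‖z‖ + 1 := by
  -- 2 is the value of t⁻¹ + t at t = 1: above it `‖φ‖` avoids 1, so by connectedness it stays on
  -- one side of 1.
  obtain ⟨r, hr, hrδ, hrall⟩ := exists_pdisk_of_eventually (hlim.eventually_gt_atTop 2) hδ
  have hsub := pdisk_mono hrδ
  have hne : ∀ z ∈ PDisk r, ‖φ z‖ ≠ 1 := fun z hz h => by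
    have := hrall z hz
    rw [h] at this
    norm_num at this
  have hdich : (∀ z ∈ PDisk r, ‖φ z‖ < 1) ∨ (∀ z ∈ PDisk r, 1 < ‖φ z‖) := by
    by_contra hcon
    push Not at hcon
    obtain ⟨⟨z, hz, hz1⟩, w, hw, hw1⟩ := hcon
    obtain ⟨y, hy, hy1⟩ := (isPreconnected_pdisk r).intermediate_value hw hz
      (hφ.continuousOn.mono hsub).norm ⟨hw1, hz1⟩
    exact hne y hy hy1
  rcases hdich with hlt | hgt
  · have h1 : Tendsto φ (𝓝[≠] 0) (𝓝 0) := by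
      rw [tendsto_zero_iff_norm_tendsto_zero]
      have h2 : Tendsto (fun z => ‖φ z‖⁻¹) (𝓝[≠] 0) atTop := by
        refine tendsto_atTop_mono' _ ?_ (tendsto_atTop_add_const_right _ (-1) hlim)
        filter_upwards [pdisk_mem_nhdsNE hr] with z hz
        linarith [hlt z hz]
      exact h2.inv_tendsto_atTop.congr fun z => by simp
    obtain ⟨K, hK⟩ := exists_inv_norm_le_of_injOn hδ hφ hinj hφ0 h1
    refine ⟨K, ?_⟩
    filter_upwards [hK, pdisk_mem_nhdsNE hr] with z hz hzr
    linarith [hlt z hzr]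
  · have h1 : Tendsto (fun z => (φ z)⁻¹) (𝓝[≠] 0) (𝓝 0) := by
      rw [tendsto_zero_iff_norm_tendsto_zero]
      have h2 : Tendsto (fun z => ‖φ z‖) (𝓝[≠] 0) atTop := by
        refine tendsto_atTop_mono' _ ?_ (tendsto_atTop_add_const_right _ (-1) hlim)
        filter_upwards [pdisk_mem_nhdsNE hr] with z hz
        linarith [inv_lt_one_of_one_lt₀ (hgt z hz)]
      exact h2.inv_tendsto_atTop.congr fun z => by simp
    obtain ⟨K, hK⟩ := exists_inv_norm_le_of_injOn hδ (hφ.inv hφ0)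
      (fun z hz w hw h => hinj hz hw (inv_injective h)) (fun z hz => inv_ne_zero (hφ0 z hz)) h1
    refine ⟨K, ?_⟩
    filter_upwards [hK, pdisk_mem_nhdsNE hr] with z hz hzr
    simp only [Pi.inv_apply, norm_inv, inv_inv] at hz
    linarith [inv_lt_one_of_one_lt₀ (hgt z hzr)]

end Injective

/-! ### An end asymptotic to a model has a simple pole -/

section AsymptoticEnd

variable {ε : ℝ} {F G : ℂ → ℂ} {ψ : ℂ → Space}

theorem norm_fst_le (x : Space) : ‖x.fst‖ ≤ ‖x‖ := by
  rw [WithLp.prod_norm_eq_of_L2]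
  exact Real.le_sqrt_of_sq_le (by nlinarith [sq_nonneg ‖x.snd‖])

/-- If an end is asymptotic to a front whose planar part grows at most like `1 / w` at `0` and like
`w` at infinity, then it has a simple pole. -/
theorem pole_order_eq_one_of_asymptotic (hψ : IsImproperAffineFront (PDisk ε) F G ψ)
    {n : ℕ} (hn : 0 < n) {b : ℂ} (hb : ‖b‖ < 1) {e : ℂ → ℂ}
    (he : AnalyticAt ℂ e 0) (he0 : e 0 ≠ 0) (hGe : ∀ᶠ z in 𝓝[≠] (0 : ℂ), z ^ n * G z = e z)
    (hH : Tendsto (fun z => z ^ n * (F z - b * G z)) (𝓝[≠] 0) (𝓝 0)) {F₀ G₀ : ℂ → ℂ} {C : ℝ}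
    (hC : 0 < C) (hFG : ∀ w ≠ 0, ‖G₀ w + conj (F₀ w)‖ ≤ C * (‖w‖⁻¹ + ‖w‖))
    (has : IsAsymptoticToPiece ε ψ F₀ G₀) : n = 1 := by
  obtain ⟨δ, ψ', hδ, hδε, ⟨Ψ, φ, v, hΨ, hφ, hφi, hφm, hψ', -⟩, hlim⟩ := has
  have hbd : ∀ᶠ z in 𝓝[≠] (0 : ℂ),
      ‖G z + conj (F z)‖ ≤ C * (‖φ z‖⁻¹ + ‖φ z‖) + (‖v‖ + 1) := by
    filter_upwards [hlim.eventually_lt_const zero_lt_one, pdisk_mem_nhdsNE hδ] with z h1 hz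
    have h2 : (ψ z).fst = (ψ z - ψ' z).fst + ((Ψ (φ z)).fst + v.fst) := by
      rw [WithLp.sub_fst, hψ' z hz, WithLp.add_fst]; ring
    rw [← hψ.fst_eq (pdisk_mono hδε hz), h2, hΨ.fst_eq (hφm hz)]
    have h3 := norm_fst_le (ψ z - ψ' z)
    have h4 := norm_fst_le v
    have h5 := hFG _ (hφm hz)
    have h6 := norm_add_le (ψ z - ψ' z).fst (G₀ (φ z) + conj (F₀ (φ z)) + v.fst)
    have h7 := norm_add_le (G₀ (φ z) + conj (F₀ (φ z))) v.fst
    linarith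
  have hinf := tendsto_cobounded_planar hn hb he he0 hGe hH
  rw [← tendsto_norm_atTop_iff_cobounded] at hinf
  have hφlim : Tendsto (fun z => ‖φ z‖⁻¹ + ‖φ z‖) (𝓝[≠] 0) atTop := by
    have h1 := (tendsto_atTop_add_const_right _ (-(‖v‖ + 1)) hinf).const_mul_atTop (inv_pos.2 hC)
    refine tendsto_atTop_mono' _ ?_ h1
    filter_upwards [hbd] with z hz
    rw [inv_mul_le_iff₀ hC]
    linarith
  obtain ⟨K, hK⟩ := exists_norm_le_of_injOn hδ hφ hφi (fun z hz => hφm hz) hφlim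
  by_contra hn1
  obtain ⟨m, rfl⟩ : ∃ m, n = m + 2 := ⟨n - 2, by omega⟩
  obtain ⟨q, hbq, hq⟩ := exists_between hb
  have hel : Tendsto e (𝓝[≠] 0) (𝓝 (e 0)) :=
    he.continuousAt.tendsto.mono_left nhdsWithin_le_nhds
  have h0 : Tendsto (fun z : ℂ => ‖z‖ ^ (m + 1) * (C * K) + ‖z‖ ^ (m + 2) * (C + (‖v‖ + 1)))
      (𝓝[≠] 0) (𝓝 0) := by
    have : Tendsto (fun z : ℂ => ‖z‖ ^ (m + 1) * (C * K) + ‖z‖ ^ (m + 2) * (C + (‖v‖ + 1)))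
      (𝓝 0) (𝓝 (‖(0 : ℂ)‖ ^ (m + 1) * (C * K) + ‖(0 : ℂ)‖ ^ (m + 2) * (C + (‖v‖ + 1)))) :=
      Continuous.tendsto (by fun_prop) 0
    simp only [norm_zero, ne_eq, Nat.add_eq_zero_iff, one_ne_zero, and_false, not_false_eq_true,
      zero_pow, OfNat.ofNat_ne_zero, zero_mul, add_zero] at this
    exact this.mono_left nhdsWithin_le_nhds
  -- After multiplication by `‖z‖ ^ (m + 2)` the lower bound `(1 - q) * ‖G z‖` has a positive limit,
  -- while the upper bound of order 1/|z| tends to 0.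
  have hle : (1 - q) * ‖e 0‖ ≤ 0 := by
    refine le_of_tendsto_of_tendsto (hel.norm.const_mul (1 - q)) h0 ?_
    filter_upwards [hbd, hK, hGe, hel.eventually_ne he0,
      (tendsto_quotient he he0 hGe hH).norm.eventually_lt_const hbq, self_mem_nhdsWithin]
      with z h1 h2 h3 h4 h5 hz
    have hz : 0 < ‖z‖ := norm_pos_iff.2 hz
    have hG0 : G z ≠ 0 := right_ne_zero_of_mul (h3 ▸ h4)
    have h6 := norm_planar_ge h5.le hG0
    have h7 : (1 - q) * ‖G z‖ ≤ C * (K / ‖z‖ + 1) + (‖v‖ + 1) := by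
      have := mul_le_mul_of_nonneg_left h2 hC.le
      linarith
    have h8 := mul_le_mul_of_nonneg_left h7 (pow_pos hz (m + 2)).le
    rw [← h3, norm_mul, norm_pow]
    calc (1 - q) * (‖z‖ ^ (m + 2) * ‖G z‖) = ‖z‖ ^ (m + 2) * ((1 - q) * ‖G z‖) := by ring
      _ ≤ _ := h8
      _ = _ := by field_simp; ring
  have := mul_pos (sub_pos.2 hq) (norm_pos_iff.2 he0)
  linarith

end AsymptoticEnd

/-! ### Reality of the residue -/

section Residue

/-- A form `Re (c dz)` with a real primitive has no period around a circle. -/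
theorem re_circleIntegral_eq_zero {h : ℂ → ℝ} {c : ℂ → ℂ} {R : ℝ} (hR : 0 ≤ R)
    (hh : ∀ z ∈ Metric.sphere (0 : ℂ) R, HasFDerivAt h (reMul (c z)) z)
    (hc : ContinuousOn c (Metric.sphere 0 R)) : (circleIntegral c 0 R).re = 0 := by
  have hm : ∀ θ, circleMap 0 R θ ∈ Metric.sphere (0 : ℂ) R := circleMap_mem_sphere 0 hR
  have hcont : Continuous fun θ : ℝ => deriv (circleMap 0 R) θ • c (circleMap 0 R θ) := by
    simp only [deriv_circleMap, smul_eq_mul]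
    exact ((continuous_circleMap 0 R).mul continuous_const).mul
      (hc.comp_continuous (continuous_circleMap 0 R) hm)
  have hint : IntervalIntegrable (fun θ : ℝ => deriv (circleMap 0 R) θ • c (circleMap 0 R θ))
      volume 0 (2 * Real.pi) := hcont.intervalIntegrable _ _
  have hre : (circleIntegral c 0 R).re =
      ∫ θ : ℝ in 0..2 * Real.pi, (deriv (circleMap 0 R) θ • c (circleMap 0 R θ)).re :=
    (Complex.reCLM.intervalIntegral_comp_comm hint).symm
  rw [hre, intervalIntegral.integral_eq_sub_of_hasDerivAt (f := fun θ => h (circleMap 0 R θ))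
    (f' := fun θ => (deriv (circleMap 0 R) θ • c (circleMap 0 R θ)).re)
    (fun θ _ => ?_) ((Complex.continuous_re.comp hcont).intervalIntegrable _ _)]
  · simp [circleMap]
  · have := (hh _ (hm θ)).comp_hasDerivAt θ (differentiable_circleMap 0 R θ).hasDerivAt
    rw [reMul_apply, mul_comm] at this
    exact this

variable {ε : ℝ} {F G : ℂ → ℂ} {h : ℂ → ℝ} {b : ℂ} {e k : ℂ → ℂ}

/-- F dG = d(bG²/2 + kG) - G dk, so -G dk also has a real part with a primitive. Its residue is
-k'(0)e(0), and 2πi times it has zero real part. -/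
theorem im_residue_eq_zero (hε : 0 < ε) (hG : DifferentiableOn ℂ G (PDisk ε))
    (hh : ∀ z ∈ PDisk ε, HasFDerivAt h (reMul (F z * deriv G z)) z)
    (he : AnalyticAt ℂ e 0) (hk : AnalyticAt ℂ k 0)
    (hGe : ∀ᶠ z in 𝓝[≠] (0 : ℂ), z * G z = e z)
    (hFk : ∀ᶠ z in 𝓝[≠] (0 : ℂ), F z = b * G z + k z) : (deriv k 0 * e 0).im = 0 := by
  obtain ⟨r, hr, hrε, hall⟩ := exists_pdisk_of_eventually (hGe.and (hFk.and
    ((he.eventually_analyticAt.and hk.eventually_analyticAt).filter_mono nhdsWithin_le_nhds))) hε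
  have hR : 0 < r / 2 := half_pos hr
  have hball : ∀ z ∈ Metric.closedBall (0 : ℂ) (r / 2), AnalyticAt ℂ e z ∧ AnalyticAt ℂ k z := by
    intro z hz
    rcases eq_or_ne z 0 with rfl | h0
    · exact ⟨he, hk⟩
    · exact (hall z ⟨norm_pos_iff.2 h0, by
        have : ‖z‖ ≤ r / 2 := by simpa using hz
        linarith⟩).2.2
  have hsph : ∀ z ∈ Metric.sphere (0 : ℂ) (r / 2), z ∈ PDisk r := fun z hz => by
    have : ‖z‖ = r / 2 := by simpa using hz
    exact ⟨this ▸ hR, by linarith⟩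
  have hd : ∀ z ∈ Metric.closedBall (0 : ℂ) (r / 2),
      DifferentiableAt ℂ (fun z => -(deriv k z * e z)) z := fun z hz =>
    ((hball z hz).2.deriv.differentiableAt.mul (hball z hz).1.differentiableAt).neg
  have hC := Complex.circleIntegral_sub_inv_smul_of_differentiable_on_off_countable
    countable_empty (Metric.mem_ball_self hR)
    (fun z hz => (hd z hz).continuousAt.continuousWithinAt)
    (fun z hz => hd z (Metric.ball_subset_closedBall hz.1))
  have hz := re_circleIntegral_eq_zero (c := fun z => (z - 0)⁻¹ • -(deriv k z * e z))
    (h := fun z => h z - (b * (G z * G z) / 2 + k z * G z).re) hR.le ?_ ?_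
  · rw [hC] at hz
    have h1 : ((2 * Real.pi * Complex.I : ℂ) • -(deriv k 0 * e 0)).re =
        2 * Real.pi * (deriv k 0 * e 0).im := by
      simp
    rw [h1] at hz
    exact (mul_eq_zero.1 hz).resolve_left (by positivity)
  · intro z hz
    have hzr := hsph z hz
    obtain ⟨h1, h2, -, h4⟩ := hall z hzr
    have hz0 : z ≠ 0 := norm_pos_iff.1 hzr.1
    have hGd := (hG.differentiableAt ((isOpen_pdisk ε).mem_nhds (pdisk_mono hrε hzr))).hasDerivAt
    have hkd := h4.differentiableAt.hasDerivAt
    have hd1 := (((hGd.mul hGd).const_mul b).div_const 2).add (hkd.mul hGd)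
    refine ((hh z (pdisk_mono hrε hzr)).sub (HasDerivAt.hasFDerivAt_re hd1)).congr_fderiv ?_
    ext v
    simp only [_root_.sub_apply, reMul_apply, ← Complex.sub_re, h2, ← h1, smul_eq_mul, sub_zero]
    congr 1
    field_simp
    ring
  · intro z hz
    have hz0 : z ≠ 0 := norm_pos_iff.1 (hsph z hz).1
    exact ((((hasDerivAt_id z).sub_const 0).continuousAt.inv₀ (by simpa using hz0)).smul
      (hd z (Metric.sphere_subset_closedBall hz)).continuousAt).continuousWithinAt

end Residue

/-! ### The model fronts -/

section Model

/-- Dividing by z brings the argument near 1, where log |w/z| is the real part of the principal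
logarithm. -/
theorem hasFDerivAt_log_norm {z : ℂ} (hz : z ≠ 0) :
    HasFDerivAt (fun w : ℂ => Real.log ‖w‖) (reMul z⁻¹) z := by
  have h1 : HasDerivAt (fun w => Complex.log (w / z)) z⁻¹ z := by
    have := ((hasDerivAt_id z).div_const z).clog (by
      simp only [id, div_self hz]; exact Complex.one_mem_slitPlane)
    simpa [hz] using this
  refine ((HasDerivAt.hasFDerivAt_re h1).add_const (Real.log ‖z‖)).congr_of_eventuallyEq ?_
  filter_upwards [eventually_ne_nhds hz] with w hw
  rw [Complex.log_re, norm_div, Real.log_div (norm_ne_zero_iff.2 hw) (norm_ne_zero_iff.2 hz)]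
  ring

/-- The real primitive of `Re (F dG)` for the data `F = a w + b / w`, `G = 1 / w`. -/
noncomputable def modelPrimitive (a : ℝ) (b w : ℂ) : ℝ :=
  (b / 2 * (w⁻¹) ^ 2).re - a * Real.log ‖w‖

theorem hasDerivAt_one_div {w : ℂ} (hw : w ≠ 0) :
    HasDerivAt (fun w : ℂ => 1 / w) (-(w ^ 2)⁻¹) w := by
  simpa only [one_div] using hasDerivAt_inv hw

theorem hasFDerivAt_modelPrimitive (a : ℝ) (b : ℂ) {w : ℂ} (hw : w ≠ 0) :
    HasFDerivAt (modelPrimitive a b)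
      (reMul ((a * w + b / w) * deriv (fun w : ℂ => 1 / w) w)) w := by
  have h1 := ((hasDerivAt_inv hw).pow 2).const_mul (b / 2)
  refine ((HasDerivAt.hasFDerivAt_re h1).sub
    ((hasFDerivAt_log_norm hw).const_mul a)).congr_fderiv ?_
  ext v
  rw [(hasDerivAt_one_div hw).deriv]
  have h2 : a • reMul w⁻¹ v = ((a : ℂ) * (w⁻¹ * v)).re := by
    rw [Complex.re_ofReal_mul, reMul_apply, smul_eq_mul]
  simp only [_root_.sub_apply, _root_.smul_apply, h2]
  simp only [reMul_apply, ← Complex.sub_re]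
  congr 1
  push_cast
  field_simp
  ring

theorem isImproperAffineFront_model (a : ℝ) (b : ℂ) :
    IsImproperAffineFront {0}ᶜ (fun w => a * w + b / w) (fun w => 1 / w)
      (frontOf (fun w => a * w + b / w) (fun w => 1 / w) (modelPrimitive a b)) := by
  refine isImproperAffineFront_frontOf isOpen_compl_singleton (fun w hw => ?_) (fun w hw => ?_)
    (fun w hw h => ?_) fun w hw => hasFDerivAt_modelPrimitive a b hw
  · have hw : w ≠ 0 := hw
    exact ((differentiableAt_id.const_mul _).add
      ((differentiableAt_const b).div differentiableAt_id hw)).differentiableWithinAt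
  · exact (hasDerivAt_one_div hw).differentiableAt.differentiableWithinAt
  · have hw : w ≠ 0 := hw
    rw [(hasDerivAt_one_div hw).deriv] at h
    exact neg_ne_zero.2 (inv_ne_zero (pow_ne_zero 2 hw)) h.2

end Model

/-! ### A simple pole gives a model -/

section Asymptotic

theorem exists_analyticAt_eq_mul {f : ℂ → ℂ} (hf : AnalyticAt ℂ f 0) (hf0 : f 0 = 0) :
    ∃ q, AnalyticAt ℂ q 0 ∧ q 0 = deriv f 0 ∧ ∀ z, f z = z * q z := by
  obtain ⟨p, hp⟩ := hf
  refine ⟨dslope f 0, ⟨_, hp.has_fpower_series_dslope_fslope⟩, dslope_same f 0, fun z => ?_⟩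
  have := sub_smul_dslope f 0 z
  rw [hf0, sub_zero, sub_zero, smul_eq_mul] at this
  exact this.symm

theorem HasFDerivAt.comp_reMul {h : ℂ → ℝ} {φ : ℂ → ℂ} {c φ' z : ℂ}
    (hh : HasFDerivAt h (reMul c) (φ z)) (hφ : HasDerivAt φ φ' z) :
    HasFDerivAt (fun w => h (φ w)) (reMul (c * φ')) z := by
  have h1 := hh.comp z (hφ.hasFDerivAt.restrictScalars ℝ)
  refine h1.congr_fderiv ?_
  ext v
  simp only [ContinuousLinearMap.comp_apply, ContinuousLinearMap.coe_restrictScalars',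
    ContinuousLinearMap.toSpanSingleton_apply, reMul_apply, smul_eq_mul]
  ring_nf

variable {ε : ℝ} {F G : ℂ → ℂ} {ψ : ℂ → Space} {b : ℂ} {e k : ℂ → ℂ}

/-- An end with a simple pole is asymptotic to a piece of a front with data
`(a w + b / w, 1 / w)`. -/
theorem exists_isAsymptoticToPiece (hε : 0 < ε) (hψ : IsImproperAffineFront (PDisk ε) F G ψ)
    (hb : ‖b‖ < 1) (he : AnalyticAt ℂ e 0) (he0 : e 0 ≠ 0) (hk : AnalyticAt ℂ k 0)
    (hGe : ∀ᶠ z in 𝓝[≠] (0 : ℂ), z * G z = e z)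
    (hFk : ∀ᶠ z in 𝓝[≠] (0 : ℂ), F z = b * G z + k z) :
    ∃ a : ℝ, IsAsymptoticToPiece ε ψ (fun w => a * w + b / w) (fun w => 1 / w) := by
  obtain ⟨h, hint, hrepr⟩ := hψ.repr
  have hh : ∀ z ∈ PDisk ε, HasFDerivAt h (reMul (F z * deriv G z)) z := fun z hz =>
    hint.hasFDerivAt (isOpen_pdisk ε) hψ.holo_F hψ.holo_G hz
  obtain ⟨a, ha⟩ : ∃ a : ℝ, (a : ℂ) = deriv k 0 * e 0 :=
    ⟨(deriv k 0 * e 0).re, Complex.ext rfl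
      (im_residue_eq_zero hε hψ.holo_G hh he hk hGe hFk).symm⟩
  -- the translation vector of the planar part
  obtain ⟨d, hd⟩ : ∃ d : ℂ, b * d - conj d = k 0 := by
    -- The equation and its conjugate form a linear system in `d` and `conj d` whose determinant is
    -- 1 - |b|² up to sign.
    have h1 : (1 : ℂ) - b * conj b ≠ 0 := by
      rw [Complex.mul_conj, ← Complex.ofReal_one, ← Complex.ofReal_sub, Complex.ofReal_ne_zero,
        Complex.normSq_eq_norm_sq]
      nlinarith [norm_nonneg b]
    have h2 : (1 : ℂ) - conj b * b ≠ 0 := by rwa [mul_comm]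
    refine ⟨-(conj b * k 0 + conj (k 0)) / (1 - b * conj b), ?_⟩
    simp only [map_div₀, map_neg, map_add, map_sub, map_mul, map_one, Complex.conj_conj]
    rw [mul_comm (conj b) b]
    field_simp
    ring
  let e₁ : ℂ → ℂ := fun z => e z + d * z
  have he₁ : AnalyticAt ℂ e₁ 0 := he.add (analyticAt_const.mul analyticAt_id)
  have he₁0 : e₁ 0 ≠ 0 := by simpa [e₁] using he0
  -- The model's parameter, chosen so that `1 / φ = G + d`.
  let φ : ℂ → ℂ := fun z => z / e₁ z
  have hφa : AnalyticAt ℂ φ 0 := analyticAt_id.div he₁ he₁0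
  have hφ0 : φ 0 = 0 := zero_div _
  have hφd : deriv φ 0 = (e 0)⁻¹ := by
    rw [(hasStrictDerivAt_div_of_ne_zero he₁ he₁0).hasDerivAt.deriv]
    simp [e₁]
  obtain ⟨s, -, hs⟩ := exists_contDiffAt_leftInverse hφa (by rw [hφd]; exact inv_ne_zero he0)
  -- The error in the other datum, `a * φ + b / φ - F - conj d`. The choice of `d` gives this form
  -- without a constant term, and that of `a` cancels the linear term.
  let ρ : ℂ → ℂ := fun z => k 0 - k z + a * φ z
  have hρa : AnalyticAt ℂ ρ 0 :=
    (analyticAt_const.sub hk).add (analyticAt_const.mul hφa)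
  have hρ0 : ρ 0 = 0 := by simp [ρ, hφ0]
  have hρd : deriv ρ 0 = 0 := by
    have h1 : HasDerivAt ρ (-deriv k 0 + a * deriv φ 0) 0 :=
      (hk.differentiableAt.hasDerivAt.const_sub (k 0)).add
        (hφa.differentiableAt.hasDerivAt.const_mul (a : ℂ))
    rw [h1.deriv, hφd, ha]
    field_simp
    ring
  obtain ⟨q₁, hq₁, hq₁0, hρq₁⟩ := exists_analyticAt_eq_mul hρa hρ0
  obtain ⟨q, hq, -, hq₁q⟩ := exists_analyticAt_eq_mul hq₁ (hq₁0.trans hρd)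
  have hρq : ∀ z, ρ z = z ^ 2 * q z := fun z => by rw [hρq₁, hq₁q]; ring
  -- This is ρ G': the double zero of ρ cancels the double pole of G' = (ze' - e)/z².
  let ρ₁ : ℂ → ℂ := fun z => q z * (z * deriv e z - e z)
  have hρ₁ : AnalyticAt ℂ ρ₁ 0 := hq.mul ((analyticAt_id.mul he.deriv).sub he)
  -- a disk on which everything is defined
  obtain ⟨δ, hδ, hδε, hall⟩ := exists_pdisk_of_eventually (hGe.and (hFk.and
    ((he.eventually_analyticAt.and (hφa.eventually_analyticAt.and (hρ₁.eventually_analyticAt.and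
      ((he₁.continuousAt.eventually_ne he₁0).and hs)))).filter_mono nhdsWithin_le_nhds))) hε
  have hsub := pdisk_mono hδε
  have hz0 : ∀ {z}, z ∈ PDisk δ → z ≠ 0 := fun hz => norm_pos_iff.1 hz.1
  have hφinv : ∀ z ∈ PDisk δ, 1 / φ z = G z + d := fun z hz => by
    obtain ⟨h1, -, -, -, -, h6, -⟩ := hall z hz
    have hz' := hz0 hz
    have h7 : e₁ z = z * (G z + d) := by simp only [e₁]; rw [← h1]; ring
    simp only [φ]
    rw [h7] at h6 ⊢
    have := right_ne_zero_of_mul h6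
    field_simp
  have hφne : ∀ z ∈ PDisk δ, φ z ≠ 0 := fun z hz =>
    div_ne_zero (hz0 hz) (hall z hz).2.2.2.2.2.1
  have hφF : ∀ z ∈ PDisk δ, a * φ z + b / φ z = F z + conj d + ρ z := fun z hz => by
    rw [div_eq_mul_one_div, hφinv z hz, (hall z hz).2.1]
    simp only [ρ]
    linear_combination hd
  have hφdiff : DifferentiableOn ℂ φ (PDisk δ) := fun z hz =>
    (hall z hz).2.2.2.1.differentiableAt.differentiableWithinAt
  have hGd : ∀ z ∈ PDisk δ, ρ z * deriv G z = ρ₁ z := fun z hz => by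
    have hz' := hz0 hz
    have h1 : G =ᶠ[𝓝 z] fun z => e z / z := by
      filter_upwards [(isOpen_pdisk δ).mem_nhds hz] with w hw
      rw [← (hall w hw).1]
      have := hz0 hw
      field_simp
    have h2 := ((hall z hz).2.2.1.differentiableAt.hasDerivAt.div (hasDerivAt_id z) hz').deriv
    rw [h1.deriv_eq, hρq]
    refine (congrArg (z ^ 2 * q z * ·) h2).trans ?_
    simp only [ρ₁, id]
    field_simp
  -- a primitive of the error term
  have hρ₁ball : DifferentiableOn ℂ ρ₁ (Metric.ball 0 δ) := fun z hz => by
    rcases eq_or_ne z 0 with rfl | h0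
    · exact hρ₁.differentiableAt.differentiableWithinAt
    · exact (hall z ⟨norm_pos_iff.2 h0, by simpa using hz⟩).2.2.2.2.1.differentiableAt
        |>.differentiableWithinAt
  obtain ⟨P, hP0, hP⟩ := hρ₁ball.isExactOn_ball.with_val_at 0 0
  have hPz : ∀ z ∈ PDisk δ, HasDerivAt P (ρ₁ z) z := fun z hz => hP z (by simpa using hz.2)
  -- Pulled back by `φ`, the model's primitive belongs to Re ((F + conj d + ρ) dG); subtracting
  -- primitives of the three summands leaves a constant.
  obtain ⟨m, hm⟩ : ∃ m : ℝ, ∀ z ∈ PDisk δ,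
      modelPrimitive a b (φ z) - h z - (conj d * G z + P z).re = m := by
    have hder : ∀ z ∈ PDisk δ, HasFDerivAt
        (fun z => modelPrimitive a b (φ z) - h z - (conj d * G z + P z).re)
        (0 : ℂ →L[ℝ] ℝ) z := fun z hz => by
      have hφz := (hφdiff.differentiableAt ((isOpen_pdisk δ).mem_nhds hz)).hasDerivAt
      have hGz := (hψ.holo_G.differentiableAt ((isOpen_pdisk ε).mem_nhds (hsub hz))).hasDerivAt
      have h1 := HasFDerivAt.comp_reMul (hasFDerivAt_modelPrimitive a b (hφne z hz)) hφz
      have h2 : deriv (fun w : ℂ => 1 / w) (φ z) * deriv φ z = deriv G z := by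
        have h3 := (hasDerivAt_one_div (hφne z hz)).differentiableAt.hasDerivAt.comp z hφz
        refine h3.unique ((hGz.add_const d).congr_of_eventuallyEq ?_)
        filter_upwards [(isOpen_pdisk δ).mem_nhds hz] with w hw using hφinv w hw
      rw [mul_assoc, h2, hφF z hz] at h1
      refine ((h1.sub (hh z (hsub hz))).sub (HasDerivAt.hasFDerivAt_re
        ((hGz.const_mul (conj d)).add (hPz z hz)))).congr_fderiv ?_
      ext v
      simp only [_root_.sub_apply, reMul_apply, ← Complex.sub_re, ← hGd z hz]
      ring_nf
      rfl
    exact (isOpen_pdisk δ).exists_is_const_of_fderiv_eq_zero (isPreconnected_pdisk δ)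
      (fun z hz => (hder z hz).differentiableAt.differentiableWithinAt)
      fun z hz => (hder z hz).fderiv
  let F₀ : ℂ → ℂ := fun w => a * w + b / w
  let G₀ : ℂ → ℂ := fun w => 1 / w
  -- Adding `d` to G and `conj d` to F moves the front horizontally by `2 * d` and vertically by
  -- `‖d‖ ^ 2 - 2 * m`, up to errors tending to 0; `v` undoes this.
  let v : Space := WithLp.toLp 2 (-(2 * d), 2 * m - ‖d‖ ^ 2)
  have hmodel := isImproperAffineFront_model a b
  have hmaps : MapsTo φ (PDisk δ) {0}ᶜ := fun z hz => hφne z hz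
  refine ⟨a, δ, fun z => frontOf F₀ G₀ (modelPrimitive a b) (φ z) + v, hδ, hδε,
    ⟨_, φ, v, hmodel, hφdiff, fun z hz w hw hzw => ?_, hmaps, fun _ _ => rfl, ?_⟩, ?_⟩
  · rw [← (hall z hz).2.2.2.2.2.2, ← (hall w hw).2.2.2.2.2.2, hzw]
  · have hev := pdisk_mem_nhdsNE hδ
    refine completeAtZero_of_tendsto (hmodel.holo_F.comp hφdiff hmaps)
      (hmodel.holo_G.comp hφdiff hmaps)
      (tendsto_cobounded_planar (n := 1) one_pos hb he₁ he₁0 ?_ ?_)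
    · filter_upwards [hev] with z hz
      rw [pow_one, Function.comp_apply, hφinv z hz, mul_add, (hall z hz).1, mul_comm z d]
    · have h1 : Tendsto (fun z : ℂ => z * (a * φ z)) (𝓝[≠] 0) (𝓝 0) := by
        have : Tendsto (fun z : ℂ => z * (a * φ z)) (𝓝 0) (𝓝 (0 * (a * φ 0))) :=
          continuousAt_id.mul (hφa.continuousAt.const_mul (a : ℂ))
        rw [zero_mul] at this
        exact this.mono_left nhdsWithin_le_nhds
      refine h1.congr fun z => ?_
      simp only [Function.comp_apply]
      ring
  · have hlim : ∀ {f : ℂ → ℂ}, ContinuousAt f 0 → f 0 = 0 → Tendsto f (𝓝[≠] 0) (𝓝 0) :=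
      fun hf hf0 => by
        have := hf.tendsto
        rw [hf0] at this
        exact this.mono_left nhdsWithin_le_nhds
    have hρl := hlim hρa.continuousAt hρ0
    have hPl := hlim (hP 0 (Metric.mem_ball_self hδ)).continuousAt hP0
    have hGl : Tendsto (fun z => G z * ρ z) (𝓝[≠] 0) (𝓝 0) := by
      have h1 : ContinuousAt (fun z => z * (e z * q z)) 0 :=
        continuousAt_id.mul (he.continuousAt.mul hq.continuousAt)
      refine (hlim h1 (zero_mul _)).congr' ?_
      filter_upwards [hGe] with z hz
      rw [hρq, ← hz]; ring
    have hFl : Tendsto (fun z => conj (F z) * ρ z) (𝓝[≠] 0) (𝓝 0) := by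
      have h1 : Tendsto (fun z => b * (G z * ρ z) + k z * ρ z) (𝓝[≠] 0) (𝓝 0) := by
        simpa using (hGl.const_mul b).add
          ((hk.continuousAt.tendsto.mono_left nhdsWithin_le_nhds).mul hρl)
      refine tendsto_zero_iff_norm_tendsto_zero.2 (h1.norm.congr' ?_ |>.trans (by simp))
      filter_upwards [hFk] with z hz
      rw [norm_mul, RCLike.norm_conj, ← norm_mul, hz]
      ring_nf
    have hre : ∀ {f : ℂ → ℂ}, Tendsto f (𝓝[≠] 0) (𝓝 0) →
        Tendsto (fun z => (f z).re) (𝓝[≠] 0) (𝓝 0) := fun hf =>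
      (Complex.continuous_re.tendsto 0).comp hf
    have h1 : Tendsto (fun z => -conj (ρ z)) (𝓝[≠] 0) (𝓝 0) := by
      simpa using ((Complex.continuous_conj.tendsto 0).comp hρl).neg
    have h2 : Tendsto (fun z => ‖ρ z‖ ^ 2 / 2 + (conj (F z) * ρ z).re - (G z * ρ z).re +
        2 * (P z).re) (𝓝[≠] 0) (𝓝 0) := by
      simpa using ((((hρl.norm.pow 2).div_const 2).add (hre hFl)).sub (hre hGl)).add
        ((hre hPl).const_mul 2)
    have h3 := ((WithLp.prodContinuousLinearEquiv 2 ℝ ℂ ℝ).symm.continuous.tendsto (0, 0)).comp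
      (h1.prodMk_nhds h2)
    have h4 := h3.norm
    rw [show ((0 : ℂ), (0 : ℝ)) = 0 from rfl, map_zero, norm_zero] at h4
    refine h4.congr' ?_
    filter_upwards [pdisk_mem_nhdsNE hδ] with z hz
    congr 1
    have hmz := hm z hz
    have hGz : G₀ (φ z) = G z + d := hφinv z hz
    have hFz : F₀ (φ z) = F z + conj d + ρ z := hφF z hz
    have hmp : modelPrimitive a b (φ z) = h z + (conj d * G z + P z).re + m := by linarith
    rw [hrepr z (hsub hz), frontOf, hGz, hFz, hmp]
    refine (WithLp.ofLp_injective 2) (Prod.ext ?_ ?_)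
    · simp [v]; ring
    · simp [v, ← Complex.normSq_eq_norm_sq, Complex.normSq_apply]; ring

end Asymptotic

/-! ### The equivalence -/

section Main

variable {ε : ℝ} {F G : ℂ → ℂ} {ψ : ℂ → Space}

/-- The end is asymptotic to one of the three models. -/
def IsAsymptoticToSomeType (ε : ℝ) (ψ : ℂ → Space) : Prop :=
  IsAsymptoticTypeP ε ψ ∨ IsAsymptoticTypeR ε ψ ∨ IsAsymptoticTypeNR ε ψ

theorem IsAsymptoticToSomeType.exists_model (h : IsAsymptoticToSomeType ε ψ) :
    ∃ (a : ℝ) (b : ℂ), IsAsymptoticToModel ε ψ (fun z => 1 / z) (fun z => a * z + b / z) := by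
  rcases h with ⟨b, -, h⟩ | ⟨a, -, h⟩ | ⟨a, b, -, -, -, h⟩
  · exact ⟨0, b, by simpa using h⟩
  · exact ⟨a, 0, by simpa using h⟩
  · exact ⟨a, b, h⟩

/-- The types are the cases a = 0, b = 0 ≠ a, and a, b ≠ 0 of a single family. -/
theorem isAsymptoticToSomeType_of_model {a : ℝ} {b : ℂ} (hb : ‖b‖ ≠ 1)
    (h : IsAsymptoticToModel ε ψ (fun z => 1 / z) (fun z => a * z + b / z)) :
    IsAsymptoticToSomeType ε ψ := by
  by_cases ha : a = 0
  · exact Or.inl ⟨b, hb, by simpa [ha] using h⟩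
  by_cases hb0 : b = 0
  · exact Or.inr (Or.inl ⟨a, ha, by simpa [hb0] using h⟩)
  · exact Or.inr (Or.inr ⟨a, b, ha, hb0, hb, h⟩)

theorem IsAsymptoticToSomeType.halfTurn (h : IsAsymptoticToSomeType ε ψ) :
    IsAsymptoticToSomeType ε (fun z => halfTurn (ψ z)) :=
  h.imp (fun ⟨b, hb, h⟩ => ⟨b, hb, h.halfTurn⟩) (Or.imp (fun ⟨a, ha, h⟩ => ⟨a, ha, h.halfTurn⟩)
    fun ⟨a, b, ha, hb, hb1, h⟩ => ⟨a, b, ha, hb, hb1, h.halfTurn⟩)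

theorem norm_one_div_add_conj_le (a : ℝ) (b : ℂ) {w : ℂ} (hw : w ≠ 0) :
    ‖1 / w + conj (a * w + b / w)‖ ≤ (1 + |a| + ‖b‖) * (‖w‖⁻¹ + ‖w‖) := by
  have h1 := norm_add_le (1 / w) (conj (a * w + b / w))
  have h2 := norm_add_le (a * w) (b / w)
  rw [RCLike.norm_conj] at h1
  rw [norm_div 1, norm_one, one_div ‖w‖] at h1
  rw [norm_mul, norm_div, Complex.norm_real, Real.norm_eq_abs, div_eq_mul_inv ‖b‖] at h2
  have h3 : 0 < ‖w‖ := norm_pos_iff.2 hw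
  have h4 : 0 < ‖w‖⁻¹ := inv_pos.2 h3
  have h5 : 0 ≤ |a| * ‖w‖⁻¹ := by positivity
  have h6 : 0 ≤ ‖b‖ * ‖w‖ := by positivity
  linarith

theorem isEmbeddedEnd_iff_of_norm_deriv_lt (hε : 0 < ε)
    (hψ : IsImproperAffineSphere (PDisk ε) F G ψ) (hc : CompleteAtZero ε F G)
    (hlt : ∀ z ∈ PDisk ε, ‖deriv F z‖ < ‖deriv G z‖) :
    IsEmbeddedEnd ε ψ ↔ IsAsymptoticToSomeType ε ψ := by
  have hfront := hψ.toIsImproperAffineFront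
  obtain ⟨n, b, e, hn, hb, he, he0, hGe, hH⟩ :=
    exists_normal_form hε hψ.holo_F hψ.holo_G hlt hc
  constructor
  · rintro ⟨δ, hδ, hδε, hsm, -, hemb⟩
    obtain rfl : n = 1 := by
      refine pole_order_eq_one_of_injOn hψ.holo_F hψ.holo_G hψ.nondegenerate hn hb he he0 hGe hH
        (x := fun z => (ψ z).snd) hδ hδε ?_ fun z hz w hw hzw => ?_
      · exact (WithLp.prod_continuous_ofLp 2 ℂ ℝ).snd.comp_continuousOn hsm.continuousOn
      · have h1 : ψ z = ψ w := by
          refine (WithLp.ofLp_injective 2) (Prod.ext ?_ (Prod.ext_iff.1 hzw).2)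
          have := (Prod.ext_iff.1 hzw).1
          simp only [← hfront.fst_eq (pdisk_mono hδε hz),
            ← hfront.fst_eq (pdisk_mono hδε hw)] at this
          exact this
        exact congrArg Subtype.val (hemb.injective (a₁ := ⟨z, hz⟩) (a₂ := ⟨w, hw⟩) h1)
    obtain ⟨k, hk, hFk⟩ := exists_analytic_remainder hε hψ.holo_F hψ.holo_G hH
    obtain ⟨a, ha⟩ := exists_isAsymptoticToPiece hε hfront hb he he0 hk
      (hGe.mono fun z hz => by simpa using hz) hFk
    -- As |dF| < |dG|, it is G that corresponds to 1/w, so the model appears with its data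
    -- interchanged.
    exact isAsymptoticToSomeType_of_model hb.ne (Or.inr ha)
  · intro h
    obtain ⟨a, b', h⟩ := h.exists_model
    have hC : 0 < 1 + |a| + ‖b'‖ := by positivity
    obtain rfl : n = 1 := by
      rcases h with h | h
      · refine pole_order_eq_one_of_asymptotic hfront hn hb he he0 hGe hH hC (fun w hw => ?_) h
        refine le_trans (le_of_eq ?_) (norm_one_div_add_conj_le a b' hw)
        rw [← RCLike.norm_conj, map_add, Complex.conj_conj, add_comm]
      · exact pole_order_eq_one_of_asymptotic hfront hn hb he he0 hGe hH hC
          (fun w hw => norm_one_div_add_conj_le a b' hw) h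
    obtain ⟨k, hk, hFk⟩ := exists_analytic_remainder hε hψ.holo_F hψ.holo_G hH
    obtain ⟨δ, hδ, hδε, hinj⟩ := exists_injOn_planar hb he he0 hk
      (hGe.mono fun z hz => by simpa using hz) hFk hε
    exact isEmbeddedEnd_of_injOn_planar hψ hδ hδε hinj

theorem norm_deriv_lt_or_gt (hψ : IsImproperAffineSphere (PDisk ε) F G ψ) :
    (∀ z ∈ PDisk ε, ‖deriv F z‖ < ‖deriv G z‖) ∨ (∀ z ∈ PDisk ε, ‖deriv G z‖ < ‖deriv F z‖) := by
  by_contra hcon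
  push Not at hcon
  obtain ⟨⟨z, hz, hz1⟩, w, hw, hw1⟩ := hcon
  obtain ⟨y, hy, hy1⟩ := (isPreconnected_pdisk ε).intermediate_value₂ hz hw
    (hψ.holo_G.deriv (isOpen_pdisk ε)).continuousOn.norm
    (hψ.holo_F.deriv (isOpen_pdisk ε)).continuousOn.norm hz1 hw1
  exact hψ.nondegenerate y hy hy1.symm

end Main

end ImproperAffine

open ImproperAffine in
theorem theorem3p2 (ε : ℝ) (hε : 0 < ε) (F G : ℂ → ℂ) (ψ : ℂ → Space)
    (hψ : IsImproperAffineSphere (PDisk ε) F G ψ) (hcomplete : CompleteAtZero ε F G) :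
    IsEmbeddedEnd ε ψ ↔
      IsAsymptoticTypeP ε ψ ∨ IsAsymptoticTypeR ε ψ ∨ IsAsymptoticTypeNR ε ψ := by
  rcases norm_deriv_lt_or_gt hψ with hlt | hgt
  · exact isEmbeddedEnd_iff_of_norm_deriv_lt hε hψ hcomplete hlt
  -- The half-turn is an involution, so both implications transfer back from the rotated front.
  · have h := isEmbeddedEnd_iff_of_norm_deriv_lt hε (hψ.halfTurn (isOpen_pdisk ε))
      hcomplete.symm hgt
    refine ⟨fun he => ?_, fun ha => ?_⟩
    · have := (h.1 he.halfTurn).halfTurn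
      simp only [halfTurn_halfTurn] at this
      exact this
    · simpa using (h.2 (IsAsymptoticToSomeType.halfTurn ha)).halfTurn
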